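/- Definitions. Let $\mathcal A$ be a finite non-empty alphabet. A *scheme* over $\mathcal A$ is a permutation $\sigma$ of $\bar{\mathcal A}=\mathcal A\times\{\mathrm b,\mathrm e\}$; write $\alpha\mathrm b,\alpha\mathrm e$ for its elements. The *dual* scheme $\sigma^*$ is given by $\sigma^*(\alpha\mathrm b)=\sigma(\alpha\mathrm e)$, $\sigma^*(\alpha\mathrm e)=\sigma(\alpha\mathrm b)$. The scheme $\sigma$ is *irreducible* if $\sigma(\mathcal A_0\times\{\mathrm b,\mathrm e\})=\mathcal A_0\times\{\mathrm b,\mathrm e\}$ only for $\mathcal A_0=\varnothing$ and $\mathcal A_0=\mathcal A$. An *interval rearrangement ensemble* (IRE) is a pair $(\sigma,\mathbf x)$ of a scheme $\sigma$ and a vector $\mathbf x\in\mathbb R^{\bar{\mathcal A}}$ with $x_{\sigma(\alpha\mathrm b)}-x_{\alpha\mathrm b}=x_{\alpha\mathrm e}-x_{\sigma(\alpha\mathrm e)}$ for all $\alpha\in\mathcal A$; this common value $v_\alpha$ is the length of $\alpha$. An IRE is *positive* if all its lengths are positive, and a scheme is *positive* if it is the scheme of some positive IRE. Two IREs are *shift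 equivalent* if they have the same scheme and the same lengths. The *twist number* of a cycle of $\sigma$ is the number of places in the cycle where an element $\alpha\mathrm b$ is followed by an element $\beta\mathrm e$, minus one. An *interval exchange scheme* is a positive scheme all of whose cycles have twist number zero, i.e. have the form $(\alpha_1\mathrm b,\dots,\alpha_m\mathrm b,\beta_n\mathrm e,\dots,\beta_1\mathrm e)$ with $m,n\ge1$. It is *rotational* if its dual is an interval exchange scheme as well. An *interval exchange* is a positive IRE $(\sigma,\mathbf x)$ whose scheme is an interval exchange scheme, and it is called rotational (irreducible) if $\sigma$ is. To each cycle $c$ of $\sigma$ corresponds the segment $J_c=\bigcup_{\alpha\mathrm b\in c}[x_{\alpha\mathrm b},x_{\sigma(\alpha\mathrm b)})$, and the mapping associated with the interval exchange translates each $[x_{\alpha\mathrm b},x_{\sigma(\alpha\mathrm b)})$ onto $[x_{\sigma(\alpha\mathrm e)},x_{\alpha\mathrm e})$. For $L>0$, $M\in\mathbb R$, let $R_{L,M}:a\mapsto a+M$ be the rotation of the circle $\mathbb R/L\mathbb Z$; it is *irrational* if the fractional part of $M/L$ is irrational. A *union of arcs* is a non-empty finite union $\Gamma$ of non-empty half-open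 arcs $[a,b)$ of the circle. The first return map onto $\Gamma$ takes $p\in\Gamma$ to the first of the points $R_{L,M}(p),R_{L,M}^2(p),\dots$ that lies in $\Gamma$. It is interpreted on the line through a fundamental segment $[x_0,x_0+L)$, where $x_0$ does not project to an interior point of $\Gamma$ (and is arbitrary if $\Gamma$ is the whole circle). It *is the interval exchange* $(\sigma,\mathbf x)$ if the segments $J_c$ of different cycles neither overlap nor touch, their union is the projection of $\Gamma$ to $[x_0,x_0+L)$, and the associated mapping is the first return map. Theorem 1. 1) For every irrational circle rotation, every union of arcs $\Gamma$ and every $x_0$ as above, the first return map onto $\Gamma$ is an irreducible rotational interval exchange. That is, it is an interval exchange $(\sigma,\mathbf x)$ for some alphabet, and whenever it is the interval exchange $(\sigma,\mathbf x)$, the scheme $\sigma$ is irreducible and rotational. 2) For every irreducible rotational interval exchange, there exists a first return map for a circle rotation onto a union of arcs that is (for some $x_0$) an interval exchange shift equivalent to the given one. 3) An irreducible interval exchange scheme $\sigma$ is rotational if and only if there exists a first return map for an irrational circle rotation onto a union of arcs that is (for some $x_0$) an interval exchange with scheme $\sigma$. -/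

import Mathlib

universe u

/-- The two sides of a label: `b` ("beginning") and `e` ("ending"). -/
inductive Side : Type
  | b
  | e

/-- A scheme over the alphabet `A`: a permutation of the doubled alphabet `A × {b, e}`. -/
abbrev Scheme (A : Type u) : Type u := Equiv.Perm (A × Side)

namespace Scheme

variable {A : Type u}

/-- The involution `αb ↔ αe` of the doubled alphabet. -/
def flip (A : Type u) : Scheme A where
  toFun ξ := match ξ with
    | (α, Side.b) => (α, Side.e)
    | (α, Side.e) => (α, Side.b)
  invFun ξ := match ξ with
    | (α, Side.b) => (α, Side.e)
    | (α, Side.e) => (α, Side.b)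
  left_inv := by rintro ⟨α, _ | _⟩ <;> rfl
  right_inv := by rintro ⟨α, _ | _⟩ <;> rfl

/-- The dual scheme: `σ*(αb) = σ(αe)` and `σ*(αe) = σ(αb)`. -/
def dual (σ : Scheme A) : Scheme A := (flip A).trans σ

theorem dual_b (σ : Scheme A) (α : A) : σ.dual (α, Side.b) = σ (α, Side.e) := rfl

theorem dual_e (σ : Scheme A) (α : A) : σ.dual (α, Side.e) = σ (α, Side.b) := rfl

/-- The doubled subset `A₀ × {b, e}`. -/
def doubled (A₀ : Set A) : Set (A × Side) := {ξ | ξ.1 ∈ A₀}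

/-- A scheme is irreducible if `σ(A₀ × {b, e}) = A₀ × {b, e}` only for `A₀ = ∅` and for the whole
alphabet. -/
def Irreducible (σ : Scheme A) : Prop :=
  ∀ A₀ : Set A, σ '' doubled A₀ = doubled A₀ → A₀ = ∅ ∨ A₀ = Set.univ

/-- A vector of endpoints `x` is allowed by `σ` if, for every label, the beginning interval and the
ending interval have the same length: `x_{σ(αb)} - x_{αb} = x_{αe} - x_{σ(αe)}`. -/
def Allows (σ : Scheme A) (x : A × Side → ℝ) : Prop :=
  ∀ α, x (σ (α, Side.b)) - x (α, Side.b) = x (α, Side.e) - x (σ (α, Side.e))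

/-- A scheme is positive if it allows a positive vector of lengths. -/
def Positive (σ : Scheme A) : Prop :=
  ∃ x : A × Side → ℝ, σ.Allows x ∧ ∀ α, 0 < x (σ (α, Side.b)) - x (α, Side.b)

/-- The twist number of the cycle of `ξ` in `σ`: the number of places in this cycle where a
beginning element is followed by an ending element, minus one. -/
noncomputable def twistNumber (σ : Scheme A) (ξ : A × Side) : ℤ :=
  (Set.ncard {α : A | σ.SameCycle ξ (α, Side.b) ∧ ∃ β : A, σ (α, Side.b) = (β, Side.e)} : ℤ) - 1

/-- An interval exchange scheme: a positive scheme, all of whose cycles have zero twist number,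
that is, have the form `(α₁b, …, αₘb, βₙe, …, β₁e)` with `m, n ≥ 1`. -/
def IsIntervalExchange (σ : Scheme A) : Prop :=
  σ.Positive ∧ ∀ ξ, σ.twistNumber ξ = 0

/-- A rotational scheme: an interval exchange scheme whose dual is one as well. -/
def IsRotational (σ : Scheme A) : Prop :=
  σ.IsIntervalExchange ∧ σ.dual.IsIntervalExchange

end Scheme

/-- An interval rearrangement ensemble (IRE): a scheme with an allowed vector of endpoints. -/
structure IRE (A : Type u) where
  /-- the scheme -/
  scheme : Scheme A
  /-- the vector of endpoints -/
  x : A × Side → ℝ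
  allowed : scheme.Allows x

namespace IRE

variable {A : Type u}

/-- The vector of lengths. -/
def length (E : IRE A) (α : A) : ℝ := E.x (E.scheme (α, Side.b)) - E.x (α, Side.b)

/-- Two IREs are shift equivalent if they have the same scheme and the same vector of lengths. -/
def ShiftEquivalent (E F : IRE A) : Prop := E.scheme = F.scheme ∧ E.length = F.length

/-- An IRE is positive if all its lengths are positive. -/
def Positive (E : IRE A) : Prop := ∀ α, 0 < E.length α

/-- An interval exchange: a positive IRE whose scheme is an interval exchange scheme. -/
def IsIntervalExchange (E : IRE A) : Prop := E.Positive ∧ E.scheme.IsIntervalExchange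

/-- A rotational interval exchange: an interval exchange whose scheme is rotational. -/
def IsRotational (E : IRE A) : Prop := E.IsIntervalExchange ∧ E.scheme.IsRotational

/-- The beginning interval `[x_{αb}, x_{σ(αb)})`. -/
def beginInterval (E : IRE A) (α : A) : Set ℝ :=
  Set.Ico (E.x (α, Side.b)) (E.x (E.scheme (α, Side.b)))

/-- The segment `J` of the cycle of `ξ`: the union of the beginning intervals in this cycle. -/
def segment (E : IRE A) (ξ : A × Side) : Set ℝ :=
  ⋃ α ∈ {α : A | E.scheme.SameCycle ξ (α, Side.b)}, E.beginInterval α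

/-- The mapping associated with an interval exchange, as a relation: `t` is mapped to `s` if, for
some label `α`, the point `t` lies in the beginning interval of `α` and `s` is its image under the
translation that carries this interval onto the ending interval `[x_{σ(αe)}, x_{αe})`. -/
def Maps (E : IRE A) (t s : ℝ) : Prop :=
  ∃ α, t ∈ E.beginInterval α ∧ s = t - E.x (α, Side.b) + E.x (E.scheme (α, Side.e))

end IRE

/-- The rotation by `M` of the circle `ℝ / Lℤ`. -/
def circleRotation (L M : ℝ) (p : AddCircle L) : AddCircle L := p + (M : AddCircle L)

/-- The rotation by `M` of the circle of length `L` is irrational: its rotation number, the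
fractional part of `M / L`, is irrational. -/
def IrrationalRotation (L M : ℝ) : Prop := Irrational (Int.fract (M / L))

/-- The arc of the circle `ℝ / Lℤ` that is the image of `[a, b)`. -/
def circleArc (L a b : ℝ) : Set (AddCircle L) := (fun t : ℝ => (t : AddCircle L)) '' Set.Ico a b

/-- `Γ` is the union of a finite non-empty family of arcs (each non-empty and of length at
most `L`). -/
def IsUnionOfArcs (L : ℝ) (Γ : Set (AddCircle L)) : Prop :=
  ∃ s : Finset (ℝ × ℝ), s.Nonempty ∧ (∀ p ∈ s, p.1 < p.2 ∧ p.2 ≤ p.1 + L) ∧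
    Γ = ⋃ p ∈ s, circleArc L p.1 p.2

/-- The first return map for `f` to `Γ`, as a relation: the first point of the trajectory
`f p, f (f p), …` that lies in `Γ` exists and is `q`. -/
def FirstReturnsTo {X : Type*} (f : X → X) (Γ : Set X) (p q : X) : Prop :=
  ∃ n : ℕ, 1 ≤ n ∧ f^[n] p = q ∧ q ∈ Γ ∧ ∀ i : ℕ, 1 ≤ i → i < n → f^[i] p ∉ Γ

/-- `x₀` is an admissible point for cutting the circle: it does not project to an interior point
of `Γ`, unless `Γ` is the whole circle, in which case `x₀` is arbitrary. -/
def IsCutPoint (L : ℝ) (Γ : Set (AddCircle L)) (x₀ : ℝ) : Prop :=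
  Γ = Set.univ ∨ (x₀ : AddCircle L) ∉ interior Γ

/-- The projection of a subset of the circle to the fundamental segment `[x₀, x₀ + L)`. -/
def circleLift (L : ℝ) (Γ : Set (AddCircle L)) (x₀ : ℝ) : Set ℝ :=
  {t | t ∈ Set.Ico x₀ (x₀ + L) ∧ (t : AddCircle L) ∈ Γ}

/-- The interval exchange `E` is the first return map for the rotation by `M` of the circle
`ℝ / Lℤ` onto `Γ`, interpreted on the real line through the fundamental segment `[x₀, x₀ + L)`. -/
structure IRE.IsFirstReturnMap {A : Type u} (E : IRE A) (L M : ℝ) (Γ : Set (AddCircle L))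
    (x₀ : ℝ) : Prop where
  isIntervalExchange : E.IsIntervalExchange
  /-- different cycles give segments that neither overlap nor touch -/
  separated : ∀ ξ η, ¬ E.scheme.SameCycle ξ η →
    Disjoint (closure (E.segment ξ)) (closure (E.segment η))
  /-- the phase space is the projection of `Γ` -/
  phaseSpace : (⋃ α, E.beginInterval α) = circleLift L Γ x₀
  /-- the mapping is the first return map -/
  firstReturn : ∀ t s : ℝ, E.Maps t s →
    FirstReturnsTo (circleRotation L M) Γ (t : AddCircle L) (s : AddCircle L)

/-!
The condition on the endpoints of an interval rearrangement ensemble reads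
`x (σ(αb)) + x (σ(αe)) = x (αb) + x (αe)`, so a scheme and its dual allow the same vectors
(`Scheme.allows_dual_iff`). For a fixed vector `x`, the dual length `x (σ(αe)) - x (αb)` of a label
is its displacement under the associated mapping. If the mapping is a first return map of a
rotation, the displacement is the return time, provided that the coordinates are measured along
the trajectories of the rotation. This relates the duality of schemes with suspensions over
first return maps, and has consequences in both directions.

*From a rotation to a scheme.* The first return map of an irrational rotation to a union of arcs is
an interval exchange (`exists_isFirstReturnMap`): the circle is cut at the points whose trajectories
meet an endpoint of an arc within a common bound of the return times, and two partitions of a set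
into intervals and their translates give a scheme (`exists_intervalExchange`). Any interval exchange
that represents the first return map is irreducible because trajectories are dense
(`IRE.IsFirstReturnMap.irreducible`). Its return times are the dual lengths of an allowed vector,
hence the dual scheme is positive (`IRE.IsFirstReturnMap.dual_positive`). Along a dual cycle one
moves between endpoints on a single trajectory without meeting the inner part of `Γ`, except at the
upper end of this piece of the trajectory; since the next visit of the inner part is an invariant
of the dual cycle (`IRE.IsFirstReturnMap.nextInner_dual`), there is one peak only.

*From a scheme to a rotation.* Let `σ` be irreducible and rotational. The additive relations and
the order of finitely many real numbers can be imitated by integers (`exists_int_family`), so there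
are integral allowed vectors with positive dual lengths. One of them can be chosen with different
coordinates within each dual cycle, and primitive in the sense that its lengths have no common
divisor, even after shifts of the dual cycles (`Scheme.IsRotational.exists_isTowerModel`). Over
each label a tower of floors is built, which are as wide as the label is long; the number of floors
is the dual length. The dual interval exchange determines which floor is to the right of a given
floor, also across the sides of the towers. Moving up respects the neighbours
(`Scheme.IsTowerModel.above_right`), hence permutes the closed chains of floors; irreducibility and
primitivity leave a single chain (`Scheme.IsTowerModel.sameCycle_right`). Thus the floors form one
circle, on which moving up is a translation, and the exchange is the first return map to the
bottoms of the towers (`Scheme.IsTowerModel.realize`). Different segments do not touch, because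
neighbouring bottoms belong to one segment (`Scheme.IsTowerModel.eq_of_right_bottom`).

Adding a multiple `θ` of the tower model to the endpoints does not change the length of the circle
and adds `θ` to the angle (`Scheme.IsTowerModel.exists_realization`); a small `θ` makes the rotation
irrational (`Scheme.IsRotational.exists_irrationalRotation`).
-/

/-! ### Peaks and valleys of the cycles of a scheme -/

theorem Equiv.Perm.SameCycle.eq_of_invariant {B Z : Type*} [Finite B] {τ : Equiv.Perm B}
    {h : B → Z} (hh : ∀ ξ, h (τ ξ) = h ξ) {ξ η : B} (hc : τ.SameCycle ξ η) : h ξ = h η := by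
  obtain ⟨n, rfl⟩ := hc.exists_nat_pow_eq
  clear hc
  induction n with
  | zero => simp
  | succ n ih => rw [pow_succ', Equiv.Perm.mul_apply, hh]; exact ih

namespace Scheme

variable {A : Type u}

/-- A scheme and its dual allow the same vectors, because the condition says
`x (σ(αb)) + x (σ(αe)) = x (αb) + x (αe)`. -/
theorem allows_dual_iff (σ : Scheme A) (x : A × Side → ℝ) : σ.dual.Allows x ↔ σ.Allows x := by
  simp only [Allows, dual_b, dual_e]
  constructor <;> intro h α <;> linarith [h α]

/-- A vector with values in an ordered set *rises* along `σ` if it increases from each beginning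
element to its successor and decreases from each ending element to its successor. The vectors
allowed by `σ` that have positive lengths are of this kind. -/
structure Rises (σ : Scheme A) {K : Type*} [LinearOrder K] (x : A × Side → K) : Prop where
  up : ∀ α, x (α, Side.b) < x (σ (α, Side.b))
  down : ∀ α, x (σ (α, Side.e)) < x (α, Side.e)

theorem Rises.of_allows {σ : Scheme A} {x : A × Side → ℝ} (h : σ.Allows x)
    (hp : ∀ α, 0 < x (σ (α, Side.b)) - x (α, Side.b)) : σ.Rises x :=
  ⟨fun α => by linarith [hp α], fun α => by linarith [hp α, h α]⟩

/-- Each cycle of `σ` has at most one place where a beginning element is followed by an ending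
element. -/
def UniquePeaks (σ : Scheme A) : Prop :=
  ∀ α α' β β', σ (α, Side.b) = (β, Side.e) → σ (α', Side.b) = (β', Side.e) →
    σ.SameCycle (α, Side.b) (α', Side.b) → α = α'

instance : Fintype Side := ⟨⟨[Side.b, Side.e], by simp⟩, by rintro (_ | _) <;> simp⟩

/-- Along a cycle, a property is lost as often as it is gained. -/
theorem card_loss_eq_card_gain [Finite A] (σ : Scheme A) (ξ : A × Side) (p : A × Side → Prop) :
    Set.ncard {ζ | σ.SameCycle ξ ζ ∧ p ζ ∧ ¬ p (σ ζ)} =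
      Set.ncard {ζ | σ.SameCycle ξ ζ ∧ ¬ p ζ ∧ p (σ ζ)} := by
  set P : Set (A × Side) := {ζ | σ.SameCycle ξ ζ ∧ p ζ}
  set Q : Set (A × Side) := {ζ | σ.SameCycle ξ ζ ∧ p (σ ζ)}
  have hQ : σ '' Q = P := by
    ext ζ
    constructor
    · rintro ⟨η, ⟨h1, h2⟩, rfl⟩
      exact ⟨Equiv.Perm.sameCycle_apply_right.2 h1, h2⟩
    · rintro ⟨h1, h2⟩
      refine ⟨σ.symm ζ, ⟨?_, by simpa using h2⟩, by simp⟩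
      rw [← Equiv.Perm.sameCycle_apply_right]
      simpa using h1
  have hcard : P.ncard = Q.ncard := by
    rw [← hQ, Set.ncard_image_of_injective _ σ.injective]
  have h1 := Set.ncard_inter_add_ncard_sdiff_eq_ncard P Q (Set.toFinite _)
  have h2 := Set.ncard_inter_add_ncard_sdiff_eq_ncard Q P (Set.toFinite _)
  rw [Set.inter_comm] at h2
  have e1 : {ζ | σ.SameCycle ξ ζ ∧ p ζ ∧ ¬ p (σ ζ)} = P \ Q := by
    ext ζ; simp only [P, Q, Set.mem_sdiff, Set.mem_ofPred_eq]; tauto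
  have e2 : {ζ | σ.SameCycle ξ ζ ∧ ¬ p ζ ∧ p (σ ζ)} = Q \ P := by
    ext ζ; simp only [P, Q, Set.mem_sdiff, Set.mem_ofPred_eq]; tauto
  rw [e1, e2]; omega

/-- If a property is lost at most once along each cycle, then it is gained at most once. -/
theorem gain_unique [Finite A] (σ : Scheme A) (p : A × Side → Prop)
    (h : ∀ ζ ζ', σ.SameCycle ζ ζ' → p ζ → ¬ p (σ ζ) → p ζ' → ¬ p (σ ζ') → ζ = ζ')
    {ζ ζ' : A × Side} (hc : σ.SameCycle ζ ζ') (h1 : ¬ p ζ) (h2 : p (σ ζ))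
    (h3 : ¬ p ζ') (h4 : p (σ ζ')) : ζ = ζ' := by
  have hle : Set.ncard {η | σ.SameCycle ζ η ∧ ¬ p η ∧ p (σ η)} ≤ 1 := by
    rw [← card_loss_eq_card_gain, Set.ncard_le_one_iff (Set.toFinite _)]
    rintro a b ⟨ha, ha1, ha2⟩ ⟨hb, hb1, hb2⟩
    exact h a b (ha.symm.trans hb) ha1 ha2 hb1 hb2
  rw [Set.ncard_le_one_iff (Set.toFinite _)] at hle
  exact hle ⟨Equiv.Perm.SameCycle.refl _ _, h1, h2⟩ ⟨hc, h3, h4⟩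

/-- If a property holds somewhere in a cycle but not everywhere, then it is lost somewhere. -/
theorem exists_loss [Finite A] (σ : Scheme A) (p : A × Side → Prop) {ζ ζ' : A × Side}
    (hc : σ.SameCycle ζ ζ') (h1 : p ζ) (h2 : ¬ p ζ') :
    ∃ η, σ.SameCycle ζ η ∧ p η ∧ ¬ p (σ η) := by
  by_contra! hcon
  obtain ⟨n, rfl⟩ := hc.exists_nat_pow_eq
  have : ∀ n : ℕ, p ((σ ^ n) ζ) := by
    intro n
    induction n with
    | zero => simpa
    | succ n ih =>
      rw [pow_succ', Equiv.Perm.mul_apply]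
      exact hcon _ ⟨n, by simp⟩ ih
  exact h2 (this n)

/-- A cycle with a single peak has a single valley, where an ending element is followed by a
beginning element. -/
theorem UniquePeaks.valley_unique [Finite A] {σ : Scheme A} (hσ : σ.UniquePeaks)
    {ζ ζ' : A × Side} (hc : σ.SameCycle ζ ζ') (h1 : ζ.2 = Side.e) (h2 : (σ ζ).2 = Side.b)
    (h3 : ζ'.2 = Side.e) (h4 : (σ ζ').2 = Side.b) : ζ = ζ' := by
  refine gain_unique σ (fun ζ => ζ.2 = Side.b) ?_ hc (by simp [h1]) h2 (by simp [h3]) h4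
  rintro ⟨a, s⟩ ⟨b, t⟩ hc h1 h2 h3 h4
  obtain rfl : s = Side.b := h1
  obtain rfl : t = Side.b := h3
  have aux : ∀ ξ : A × Side, ¬ ξ.2 = Side.b → ξ = (ξ.1, Side.e) := by
    rintro ⟨c, _ | _⟩ h <;> simp_all
  rw [hσ a b _ _ (aux _ h2) (aux _ h4) hc]

section Order

variable {K : Type*} [LinearOrder K] {σ : Scheme A} {x : A × Side → K}

/-- The predecessor of a maximum along a cycle is a beginning element, the maximum itself is an
ending element. -/
theorem Rises.peak_of_forall_le (h : σ.Rises x) {η : A × Side}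
    (hη : ∀ ζ, σ.SameCycle η ζ → x ζ ≤ x η) :
    ∃ α β, σ (α, Side.b) = (β, Side.e) ∧ η = (β, Side.e) := by
  obtain ⟨β, s⟩ := η
  have hs : s = Side.e := by
    rcases s with _ | _
    · exact absurd (hη (σ (β, Side.b)) (by simp [Equiv.Perm.SameCycle.refl])) (not_le.2 (h.up β))
    · rfl
  subst hs
  obtain ⟨⟨α, t⟩, hα⟩ := σ.surjective (β, Side.e)
  have ht : t = Side.b := by
    rcases t with _ | _
    · rfl
    · exfalso
      have h1 := hη (α, Side.e) (by rw [← hα]; simp [Equiv.Perm.SameCycle.refl])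
      have h2 := h.down α
      rw [hα] at h2
      exact absurd h1 (not_le.2 h2)
  subst ht
  exact ⟨α, β, hα, rfl⟩

variable [Finite A]

theorem exists_max (σ : Scheme A) (x : A × Side → K) (ξ : A × Side) :
    ∃ η, σ.SameCycle ξ η ∧ ∀ ζ, σ.SameCycle ξ ζ → x ζ ≤ x η :=
  Set.exists_max_image {ζ | σ.SameCycle ξ ζ} x (Set.toFinite _) ⟨ξ, Equiv.Perm.SameCycle.refl _ _⟩

theorem Rises.exists_peak (h : σ.Rises x) (ξ : A × Side) :
    ∃ α β, σ (α, Side.b) = (β, Side.e) ∧ σ.SameCycle ξ (α, Side.b) := by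
  obtain ⟨η, h1, h2⟩ := exists_max σ x ξ
  obtain ⟨α, β, h3, rfl⟩ := h.peak_of_forall_le (η := η) fun ζ hζ => h2 ζ (h1.trans hζ)
  refine ⟨α, β, h3, ?_⟩
  rw [← Equiv.Perm.sameCycle_apply_right, h3]
  exact h1

/-- At the peak of a cycle the coordinate is the strict maximum over this cycle. -/
theorem Rises.lt_peak (h : σ.Rises x) (hσ : σ.UniquePeaks) {α β : A}
    (hα : σ (α, Side.b) = (β, Side.e)) {ζ : A × Side} (hζ : σ.SameCycle (β, Side.e) ζ)
    (hne : ζ ≠ (β, Side.e)) : x ζ < x (β, Side.e) := by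
  have key : ∀ η, σ.SameCycle (β, Side.e) η → (∀ ζ, σ.SameCycle (β, Side.e) ζ → x ζ ≤ x η) →
      η = (β, Side.e) := by
    intro η h1 h2
    obtain ⟨γ, δ, h3, rfl⟩ := h.peak_of_forall_le (η := η) fun ζ hζ => h2 ζ (h1.trans hζ)
    have : α = γ := hσ α γ β δ hα h3 (by
      rw [← Equiv.Perm.sameCycle_apply_left, ← Equiv.Perm.sameCycle_apply_right, hα, h3]
      exact h1)
    rw [← h3, ← this, hα]
  obtain ⟨η, h1, h2⟩ := exists_max σ x (β, Side.e)
  obtain rfl := key η h1 h2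
  refine lt_of_le_of_ne (h2 ζ hζ) fun heq => hne (key ζ hζ fun ζ' h' => ?_)
  rw [heq]
  exact h2 ζ' h'

/-- Beginning intervals of one cycle that share a point coincide. -/
theorem Rises.begin_unique (h : σ.Rises x) (hσ : σ.UniquePeaks) {α α' : A} {t : K}
    (hc : σ.SameCycle (α, Side.b) (α', Side.b))
    (ht : t ∈ Set.Ico (x (α, Side.b)) (x (σ (α, Side.b))))
    (ht' : t ∈ Set.Ico (x (α', Side.b)) (x (σ (α', Side.b)))) : α = α' := by
  -- being a beginning element at or below the level `t` is gained only at the valley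
  have key : ∀ ζ ζ', σ.SameCycle ζ ζ' →
      ¬ (¬ (ζ.2 = Side.b ∧ x ζ ≤ t)) → (¬ ((σ ζ).2 = Side.b ∧ x (σ ζ) ≤ t)) →
      ¬ (¬ (ζ'.2 = Side.b ∧ x ζ' ≤ t)) → (¬ ((σ ζ').2 = Side.b ∧ x (σ ζ') ≤ t)) → ζ = ζ' := by
    intro ζ ζ' hc h1 h2 h3 h4
    refine gain_unique σ (fun ζ => ¬ (ζ.2 = Side.b ∧ x ζ ≤ t)) ?_ hc h1 h2 h3 h4
    have aux : ∀ ζ : A × Side, ¬ (ζ.2 = Side.b ∧ x ζ ≤ t) →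
        ¬ ¬ ((σ ζ).2 = Side.b ∧ x (σ ζ) ≤ t) → ζ.2 = Side.e ∧ (σ ζ).2 = Side.b := by
      rintro ⟨a, _ | _⟩ h1 h2
      · simp only [true_and, not_le] at h1
        simp only [not_not] at h2
        exact absurd (lt_of_lt_of_le (h1.trans (h.up a)) h2.2) (lt_irrefl _)
      · simp only [not_not] at h2
        exact ⟨rfl, h2.1⟩
    intro ζ ζ' hc h1 h2 h3 h4
    exact hσ.valley_unique hc (aux ζ h1 h2).1 (aux ζ h1 h2).2 (aux ζ' h3 h4).1 (aux ζ' h3 h4).2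
  have := key (α, Side.b) (α', Side.b) hc (by simp [ht.1]) (by simp [ht.2])
    (by simp [ht'.1]) (by simp [ht'.2])
  exact congrArg Prod.fst this

/-- Ending intervals of one cycle that share a point coincide. -/
theorem Rises.end_unique (h : σ.Rises x) (hσ : σ.UniquePeaks) {β β' : A} {t : K}
    (hc : σ.SameCycle (β, Side.e) (β', Side.e))
    (ht : t ∈ Set.Ico (x (σ (β, Side.e))) (x (β, Side.e)))
    (ht' : t ∈ Set.Ico (x (σ (β', Side.e))) (x (β', Side.e))) : β = β' := by
  -- the level `t` is crossed downwards as often as it is crossed upwards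
  have := gain_unique σ (fun ζ => x ζ ≤ t) (ζ := (β, Side.e)) (ζ' := (β', Side.e)) ?_ hc
    (by simp [ht.2]) (by simp [ht.1]) (by simp [ht'.2]) (by simp [ht'.1])
  · exact congrArg Prod.fst this
  have aux : ∀ a : A, x (a, Side.e) ≤ t → ¬ x (σ (a, Side.e)) ≤ t → False := fun a h1 h2 =>
    h2 ((h.down a).le.trans h1)
  rintro ⟨a, _ | _⟩ ⟨b, _ | _⟩ hc h1 h2 h3 h4
  · rw [h.begin_unique hσ hc ⟨h1, not_le.1 h2⟩ ⟨h3, not_le.1 h4⟩]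
  · exact (aux _ h3 h4).elim
  · exact (aux _ h1 h2).elim
  · exact (aux _ h1 h2).elim

/-- Every point of an ending interval lies in a beginning interval of the same cycle. -/
theorem Rises.exists_begin (h : σ.Rises x) {β : A} {t : K}
    (ht : t ∈ Set.Ico (x (σ (β, Side.e))) (x (β, Side.e))) :
    ∃ α, σ.SameCycle (β, Side.e) (α, Side.b) ∧
      t ∈ Set.Ico (x (α, Side.b)) (x (σ (α, Side.b))) := by
  obtain ⟨⟨a, s⟩, h1, h2, h3⟩ := exists_loss σ (fun ζ => x ζ ≤ t) (ζ := σ (β, Side.e))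
    (ζ' := (β, Side.e)) (by simp [Equiv.Perm.SameCycle.refl]) ht.1 (by simpa using ht.2)
  rcases s with _ | _
  · exact ⟨a, by simpa using h1, h2, not_le.1 h3⟩
  · exact (h3 ((h.down a).le.trans h2)).elim

theorem Rises.exists_valley (h : σ.Rises x) (ξ : A × Side) :
    ∃ β α, σ (β, Side.e) = (α, Side.b) ∧ σ.SameCycle ξ (β, Side.e) := by
  obtain ⟨α, β, h1, h2⟩ := h.exists_peak ξ
  obtain ⟨⟨a, s⟩, h3, h4, h5⟩ := exists_loss σ (fun ζ => ζ.2 = Side.e) (ζ := (β, Side.e))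
    (ζ' := (α, Side.b)) (by rw [← h1]; simp [Equiv.Perm.SameCycle.refl]) rfl (by simp)
  obtain rfl : s = Side.e := h4
  refine ⟨a, (σ (a, Side.e)).1, ?_, h2.trans (by rw [← h1] at h3; simpa using h3)⟩
  rcases hη : σ (a, Side.e) with ⟨c, _ | _⟩
  · rfl
  · simp [hη] at h5

/-- At the valley of a cycle the coordinate is the strict minimum over this cycle. -/
theorem Rises.valley_lt (h : σ.Rises x) (hσ : σ.UniquePeaks) {α β : A}
    (hβ : σ (β, Side.e) = (α, Side.b)) {ζ : A × Side} (hζ : σ.SameCycle (α, Side.b) ζ)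
    (hne : ζ ≠ (α, Side.b)) : x (α, Side.b) < x ζ := by
  have key : ∀ η, σ.SameCycle (α, Side.b) η → (∀ ζ, σ.SameCycle (α, Side.b) ζ → x η ≤ x ζ) →
      η = (α, Side.b) := by
    rintro ⟨γ, s⟩ h1 h2
    rcases s with _ | _
    · obtain ⟨⟨δ, t⟩, hδ⟩ := σ.surjective (γ, Side.b)
      have hc : σ.SameCycle (α, Side.b) (δ, t) := by
        rwa [← Equiv.Perm.sameCycle_apply_right, hδ]
      rcases t with _ | _
      · exact absurd (h2 _ hc) (not_le.2 (by rw [← hδ]; exact h.up δ))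
      · have := hσ.valley_unique (ζ := (β, Side.e)) (ζ' := (δ, Side.e))
          (by rw [← Equiv.Perm.sameCycle_apply_left, hβ]; exact hc) rfl (by rw [hβ]) rfl
          (by rw [hδ])
        rw [← hδ, ← this, hβ]
    · exact absurd (h2 (σ (γ, Side.e)) (by simpa using h1)) (not_le.2 (h.down γ))
  obtain ⟨η, h1, h2⟩ : ∃ η, σ.SameCycle (α, Side.b) η ∧
      ∀ ζ, σ.SameCycle (α, Side.b) ζ → x η ≤ x ζ :=
    Set.exists_min_image {ζ | σ.SameCycle (α, Side.b) ζ} x (Set.toFinite _)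
      ⟨_, Equiv.Perm.SameCycle.refl _ _⟩
  obtain rfl := key η h1 h2
  refine lt_of_le_of_ne (h2 ζ hζ) fun heq => hne (key ζ hζ fun ζ' h' => ?_)
  rw [← heq]
  exact h2 ζ' h'

/-- A function of labels that does not change from `α` to `β` when `αb` is followed by `βb`
is constant over the beginning elements of each cycle. -/
theorem Rises.eq_of_sameCycle (h : σ.Rises x) (hσ : σ.UniquePeaks) {Z : Type*} {f : A → Z}
    (hf : ∀ α β, σ (α, Side.b) = (β, Side.b) → f α = f β) {α α' : A}
    (hc : σ.SameCycle (α, Side.b) (α', Side.b)) : f α = f α' := by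
  have key : ∀ α, ∃ γ δ, σ (γ, Side.b) = (δ, Side.e) ∧ σ.SameCycle (α, Side.b) (γ, Side.b) ∧
      f α = f γ := by
    intro α
    obtain ⟨γ, δ, h1, h2⟩ := h.exists_peak (α, Side.b)
    obtain ⟨⟨a, s⟩, h3, h4, h5⟩ := exists_loss σ (fun ζ => ζ.2 = Side.b ∧ f ζ.1 = f α)
      (ζ := (α, Side.b)) (ζ' := (δ, Side.e)) (by rw [← h1]; simpa using h2) ⟨rfl, rfl⟩
      (by simp)
    obtain ⟨rfl, h6⟩ : s = Side.b ∧ f a = f α := h4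
    rcases hη : σ (a, Side.b) with ⟨c, _ | _⟩
    · exact absurd ⟨by rw [hη], by rw [hη, ← h6]; exact (hf a c hη).symm⟩ h5
    · exact ⟨a, c, hη, h3, h6.symm⟩
  obtain ⟨γ, δ, h1, h2, h3⟩ := key α
  obtain ⟨γ', δ', h1', h2', h3'⟩ := key α'
  rw [h3, h3', hσ γ γ' δ δ' h1 h1' (h2.symm.trans (hc.trans h2'))]

end Order

/-- The zero twist condition in an interval exchange scheme leaves a single peak in each cycle. -/
theorem IsIntervalExchange.uniquePeaks [Finite A] {σ : Scheme A} (h : σ.IsIntervalExchange) :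
    σ.UniquePeaks := by
  intro α α' β β' h1 h2 h3
  have := h.2 (α, Side.b)
  rw [twistNumber, sub_eq_zero] at this
  have hle := (Nat.cast_eq_one (R := ℤ)).1 this |>.le
  rw [Set.ncard_le_one_iff (Set.toFinite _)] at hle
  exact hle ⟨Equiv.Perm.SameCycle.refl _ _, β, h1⟩ ⟨h3, β', h2⟩

theorem Positive.isIntervalExchange [Finite A] {σ : Scheme A} (h : σ.Positive)
    (hσ : σ.UniquePeaks) : σ.IsIntervalExchange := by
  refine ⟨h, fun ξ => ?_⟩
  obtain ⟨x, hx, hp⟩ := h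
  obtain ⟨α, β, h1, h2⟩ := (Rises.of_allows hx hp).exists_peak ξ
  rw [twistNumber, sub_eq_zero, Nat.cast_eq_one, Set.ncard_eq_one]
  refine ⟨α, Set.eq_singleton_iff_unique_mem.2 ⟨⟨h2, β, h1⟩, ?_⟩⟩
  rintro γ ⟨h3, δ, h4⟩
  exact hσ γ α δ β h4 h1 (h3.symm.trans h2)

end Scheme

/-! ### Rotations of a circle -/

section Rotation

variable {L M : ℝ}

theorem iterate_circleRotation (n : ℕ) (p : AddCircle L) :
    (circleRotation L M)^[n] p = p + n • (M : AddCircle L) := by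
  induction n with
  | zero => simp
  | succ n ih => rw [Function.iterate_succ_apply', ih, circleRotation, succ_nsmul, add_assoc]

theorem IrrationalRotation.irrational (h : IrrationalRotation L M) : Irrational (M / L) := by
  rw [← Int.floor_add_fract (M / L)]
  exact Irrational.intCast_add h _

theorem IrrationalRotation.neg (h : IrrationalRotation L M) : IrrationalRotation L (-M) := by
  have : Irrational (-M / L) := by
    rw [neg_div]
    exact h.irrational.neg
  rw [IrrationalRotation, Int.fract]
  exact this.sub_intCast _

theorem IrrationalRotation.zsmul_injective (hL : 0 < L) (h : IrrationalRotation L M) :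
    Function.Injective fun k : ℤ => k • (M : AddCircle L) := by
  intro k j hkj
  by_contra hne
  have h1 : (k - j) • (M : AddCircle L) = 0 := by
    rw [sub_zsmul]
    exact sub_eq_zero.2 hkj
  rw [← AddCircle.coe_zsmul, AddCircle.coe_eq_zero_iff] at h1
  obtain ⟨i, hi⟩ := h1
  apply h.irrational
  refine ⟨(i : ℚ) / ((k - j : ℤ) : ℚ), ?_⟩
  have h2 : ((k - j : ℤ) : ℝ) ≠ 0 := by exact_mod_cast sub_ne_zero.2 hne
  simp only [zsmul_eq_mul] at hi
  push_cast at hi h2 ⊢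
  rw [div_eq_div_iff h2 hL.ne']
  linarith

theorem IrrationalRotation.exists_nsmul_mem (hL : 0 < L) (h : IrrationalRotation L M)
    (p : AddCircle L) {V : Set (AddCircle L)} (hV : IsOpen V) (hne : V.Nonempty) :
    ∃ n : ℕ, 1 ≤ n ∧ p + n • (M : AddCircle L) ∈ V := by
  have : Fact (0 < L) := ⟨hL⟩
  have hd : DenseRange fun n : ℕ => n • (M : AddCircle L) := by
    rw [← denseRange_zsmul_iff_nsmul, AddCircle.denseRange_zsmul_coe_iff]
    exact h.irrational
  have hcont : Continuous fun q : AddCircle L => p + M + q := by fun_prop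
  obtain ⟨n, hn⟩ := hd.exists_mem_open (hV.preimage hcont) (by
    obtain ⟨q, hq⟩ := hne
    exact ⟨q - (p + M), by simpa using hq⟩)
  refine ⟨n + 1, by omega, ?_⟩
  rw [succ_nsmul, add_comm _ (M : AddCircle L), ← add_assoc]
  exact hn

/-- Time coordinates along the trajectories of an irrational rotation. -/
theorem IrrationalRotation.exists_time (hL : 0 < L) (h : IrrationalRotation L M) :
    ∃ T : AddCircle L → ℤ, ∀ p (k : ℤ), T (p + k • (M : AddCircle L)) = T p + k := by
  set H := AddSubgroup.zmultiples (M : AddCircle L)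
  have hex : ∀ p : AddCircle L, ∃ k : ℤ,
      p = (QuotientAddGroup.mk p : AddCircle L ⧸ H).out + k • (M : AddCircle L) := by
    intro p
    have : (QuotientAddGroup.mk (QuotientAddGroup.mk p : AddCircle L ⧸ H).out : AddCircle L ⧸ H) =
        QuotientAddGroup.mk p := Quotient.out_eq' _
    rw [QuotientAddGroup.eq] at this
    obtain ⟨k, hk⟩ := AddSubgroup.mem_zmultiples_iff.1 this
    exact ⟨k, by rw [hk]; abel⟩
  choose T hT using hex
  refine ⟨T, fun p k => h.zsmul_injective hL ?_⟩
  have h1 : (QuotientAddGroup.mk (p + k • (M : AddCircle L)) : AddCircle L ⧸ H) =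
      QuotientAddGroup.mk p := by
    rw [eq_comm, QuotientAddGroup.eq]
    exact AddSubgroup.mem_zmultiples_iff.2 ⟨k, by abel⟩
  have h2 := hT (p + k • (M : AddCircle L))
  rw [h1] at h2
  have h3 := hT p
  simp only
  rw [add_zsmul]
  have h4 : (QuotientAddGroup.mk p : AddCircle L ⧸ H).out = p - T p • (M : AddCircle L) := by
    rw [eq_sub_iff_add_eq]; exact h3.symm
  rw [h4] at h2
  have h5 : T (p + k • (M : AddCircle L)) • (M : AddCircle L) =
      p + k • (M : AddCircle L) - (p - T p • (M : AddCircle L)) := by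
    rw [eq_sub_iff_add_eq, add_comm]; exact h2.symm
  rw [h5]; abel

end Rotation

/-- If a trajectory avoids a set for some time, its first hit may be computed from the point
reached by then. -/
theorem firstReturnsTo_iff_of_avoids {X : Type*} {f : X → X} {V : Set X} {p : X} {n : ℕ}
    (hn : 1 ≤ n) (h : ∀ i, 1 ≤ i → i < n → f^[i] p ∉ V) (q : X) :
    FirstReturnsTo f V p q ↔
      (f^[n] p ∈ V ∧ q = f^[n] p) ∨ (f^[n] p ∉ V ∧ FirstReturnsTo f V (f^[n] p) q) := by
  constructor
  · rintro ⟨k, hk, rfl, hq, hk'⟩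
    have hnk : n ≤ k := by
      by_contra! hlt
      exact h k hk hlt hq
    obtain rfl | hlt := hnk.eq_or_lt
    · exact Or.inl ⟨hq, rfl⟩
    · refine Or.inr ⟨hk' n hn hlt, k - n, by omega, ?_, hq, fun i hi hi' => ?_⟩
      · rw [← Function.iterate_add_apply, Nat.sub_add_cancel hnk]
      · rw [← Function.iterate_add_apply]
        exact hk' _ (by omega) (by omega)
  · rintro (⟨h1, rfl⟩ | ⟨h1, k, hk, rfl, hq, hk'⟩)
    · exact ⟨n, hn, rfl, h1, h⟩
    · refine ⟨k + n, by omega, Function.iterate_add_apply _ _ _ _, hq, fun i hi hi' => ?_⟩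
      rcases lt_trichotomy i n with h2 | rfl | h2
      · exact h i hi h2
      · exact h1
      · have := hk' (i - n) (by omega) (by omega)
        rwa [← Function.iterate_add_apply, Nat.sub_add_cancel h2.le] at this

/-! ### First return maps are irreducible and rotational -/

namespace IRE

variable {A : Type u} {E : IRE A} {L M : ℝ} {Γ : Set (AddCircle L)} {x₀ : ℝ}

theorem Positive.rises (h : E.Positive) : E.scheme.Rises E.x := Scheme.Rises.of_allows E.allowed h

/-- The displacement of the interval of the given label under the associated mapping. -/
def displacement (E : IRE A) (α : A) : ℝ := E.x (E.scheme (α, Side.e)) - E.x (α, Side.b)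

namespace IsFirstReturnMap

theorem rises (h : E.IsFirstReturnMap L M Γ x₀) : E.scheme.Rises E.x := h.1.1.rises

theorem uniquePeaks [Finite A] (h : E.IsFirstReturnMap L M Γ x₀) : E.scheme.UniquePeaks :=
  h.1.2.uniquePeaks

theorem begin_mem (h : E.IsFirstReturnMap L M Γ x₀) (α : A) :
    E.x (α, Side.b) ∈ E.beginInterval α := ⟨le_rfl, h.rises.up α⟩

/-- Along each label, the first return time is constant. -/
theorem exists_returnTime (hL : 0 < L) (hM : IrrationalRotation L M)
    (h : E.IsFirstReturnMap L M Γ x₀) (α : A) :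
    ∃ n : ℕ, 1 ≤ n ∧ n • (M : AddCircle L) = (E.displacement α : AddCircle L) ∧
      ∀ t ∈ E.beginInterval α, ((t + E.displacement α : ℝ) : AddCircle L) ∈ Γ ∧
        ∀ i : ℕ, 1 ≤ i → i < n → (t : AddCircle L) + i • (M : AddCircle L) ∉ Γ := by
  have key : ∀ t ∈ E.beginInterval α, ∃ n : ℕ, 1 ≤ n ∧
      n • (M : AddCircle L) = (E.displacement α : AddCircle L) ∧
      ((t + E.displacement α : ℝ) : AddCircle L) ∈ Γ ∧
        ∀ i : ℕ, 1 ≤ i → i < n → (t : AddCircle L) + i • (M : AddCircle L) ∉ Γ := by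
    intro t ht
    obtain ⟨n, h1, h2, h3, h4⟩ := h.firstReturn t (t + E.displacement α)
      ⟨α, ht, by rw [displacement]; ring⟩
    simp only [iterate_circleRotation] at h2 h4
    exact ⟨n, h1, by simpa using h2, h3, h4⟩
  obtain ⟨n, h1, h2, -⟩ := key _ (h.begin_mem α)
  refine ⟨n, h1, h2, fun t ht => ?_⟩
  obtain ⟨m, h3, h4, h5, h6⟩ := key t ht
  have : (m : ℤ) = n := hM.zsmul_injective hL (by simpa using h4.trans h2.symm)
  rw [Nat.cast_inj] at this
  subst this
  exact ⟨h5, h6⟩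

theorem end_eq (E : IRE A) (α : A) :
    E.x (α, Side.e) = E.x (E.scheme (α, Side.b)) + E.displacement α := by
  have := E.allowed α
  rw [displacement]; linarith

/-- The return times are lengths for the dual scheme: the time coordinates of the endpoints along
the trajectories of the rotation form a vector allowed by it. -/
theorem dual_positive (hL : 0 < L) (hM : IrrationalRotation L M)
    (h : E.IsFirstReturnMap L M Γ x₀) : E.scheme.dual.Positive := by
  obtain ⟨T, hT⟩ := hM.exists_time hL
  choose n h1 h2 h3 using h.exists_returnTime hL hM
  have e1 : ∀ α, T (E.x (E.scheme (α, Side.e))) = T (E.x (α, Side.b)) + n α := by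
    intro α
    rw [← hT, natCast_zsmul, h2, ← AddCircle.coe_add, displacement]
    ring_nf
  have e2 : ∀ α, T (E.x (α, Side.e)) = T (E.x (E.scheme (α, Side.b))) + n α := by
    intro α
    rw [← hT, natCast_zsmul, h2, ← AddCircle.coe_add, end_eq]
  refine ⟨fun ξ => T (E.x ξ), fun α => ?_, fun α => ?_⟩
  · simp only [Scheme.dual_b, Scheme.dual_e, e1, e2]
    push_cast
    ring
  · simp only [Scheme.dual_b, e1]
    have := h1 α
    push_cast
    simp only [add_sub_cancel_left]
    exact_mod_cast this

theorem beginInterval_subset (h : E.IsFirstReturnMap L M Γ x₀) (α : A) :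
    E.beginInterval α ⊆ circleLift L Γ x₀ := by
  rw [← h.phaseSpace]
  exact Set.subset_iUnion E.beginInterval α

theorem beginInterval_subset_segment {ξ : A × Side} {α : A}
    (hc : E.scheme.SameCycle ξ (α, Side.b)) : E.beginInterval α ⊆ E.segment ξ :=
  Set.subset_biUnion_of_mem (u := E.beginInterval) hc

theorem sameCycle_of_mem (h : E.IsFirstReturnMap L M Γ x₀) {α β : A} {t : ℝ}
    (h1 : t ∈ closure (E.beginInterval α)) (h2 : t ∈ closure (E.beginInterval β)) :
    E.scheme.SameCycle (α, Side.b) (β, Side.b) := by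
  by_contra hcon
  exact Set.disjoint_left.1 (h.separated _ _ hcon)
    (closure_mono (beginInterval_subset_segment (Equiv.Perm.SameCycle.refl _ _)) h1)
    (closure_mono (beginInterval_subset_segment (Equiv.Perm.SameCycle.refl _ _)) h2)

variable [Finite A]

theorem eq_of_mem (h : E.IsFirstReturnMap L M Γ x₀) {α β : A} {t : ℝ}
    (h1 : t ∈ E.beginInterval α) (h2 : t ∈ E.beginInterval β) : α = β :=
  h.rises.begin_unique h.uniquePeaks (h.sameCycle_of_mem (subset_closure h1) (subset_closure h2))
    h1 h2

theorem endInterval_subset (h : E.IsFirstReturnMap L M Γ x₀) (α : A) :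
    Set.Ico (E.x (E.scheme (α, Side.e))) (E.x (α, Side.e)) ⊆ circleLift L Γ x₀ := by
  intro t ht
  obtain ⟨β, -, hβ⟩ := h.rises.exists_begin ht
  exact h.beginInterval_subset β hβ

theorem inner_mem (hL : 0 < L) {a b t : ℝ} (hab : Set.Ioo a b ⊆ circleLift L Γ x₀)
    (ht : t ∈ Set.Ioo a b) : (t : AddCircle L) ∈ interior Γ \ {(x₀ : AddCircle L)} := by
  have : Fact (0 < L) := ⟨hL⟩
  constructor
  · refine mem_interior.2 ⟨(fun s : ℝ => (s : AddCircle L)) '' Set.Ioo a b, ?_, ?_, t, ht, rfl⟩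
    · rintro _ ⟨s, hs, rfl⟩
      exact (hab hs).2
    · exact QuotientAddGroup.isOpenMap_coe _ isOpen_Ioo
  · intro heq
    obtain ⟨s, hs1, hs2⟩ := exists_between ht.1
    have h1 := (hab ⟨hs1, hs2.trans ht.2⟩).1.1
    have h2 := (AddCircle.coe_eq_coe_iff_of_mem_Ico (hab ht).1
      (Set.left_mem_Ico.2 (by linarith : x₀ < x₀ + L))).1 heq
    linarith

/-- The right end of a segment is not an interior point of `Γ`, apart from the cut point. -/
theorem peak_notMem (h : E.IsFirstReturnMap L M Γ x₀) {α β : A}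
    (hα : E.scheme (α, Side.b) = (β, Side.e)) :
    (E.x (β, Side.e) : AddCircle L) ∉ interior Γ \ {(x₀ : AddCircle L)} := by
  rintro ⟨h1, h2⟩
  have hup := h.rises.up α
  rw [hα] at hup
  have hle : E.x (β, Side.e) ≤ x₀ + L := by
    refine le_of_forall_lt fun t ht => ?_
    obtain ⟨s, hs1, hs2⟩ := exists_between (max_lt hup ht)
    have := (h.beginInterval_subset α (⟨((le_max_left _ _).trans_lt hs1).le, by
      rw [hα]; exact hs2⟩ : s ∈ E.beginInterval α)).1.2
    exact (le_max_right _ _).trans_lt (hs1.trans this)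
  have hne : E.x (β, Side.e) ≠ x₀ + L := by
    intro heq
    rw [heq] at h2
    simp at h2
  have hge := (h.beginInterval_subset α (h.begin_mem α)).1.1
  have hmem : E.x (β, Side.e) ∈ circleLift L Γ x₀ :=
    ⟨⟨hge.trans hup.le, lt_of_le_of_ne hle hne⟩, interior_subset h1⟩
  rw [← h.phaseSpace] at hmem
  obtain ⟨γ, hγ⟩ := Set.mem_iUnion.1 hmem
  have hc : E.scheme.SameCycle (α, Side.b) (γ, Side.b) := by
    refine h.sameCycle_of_mem ?_ (subset_closure hγ)
    rw [beginInterval, closure_Ico (h.rises.up α).ne, hα]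
    exact ⟨hup.le, le_rfl⟩
  have hc' : E.scheme.SameCycle (β, Side.e) (E.scheme (γ, Side.b)) := by
    rw [← hα, Equiv.Perm.sameCycle_apply_left, Equiv.Perm.sameCycle_apply_right]
    exact hc
  have h3 := hγ.2
  have := h.rises.lt_peak h.uniquePeaks hα hc' (fun heq => by simp [heq] at h3)
  exact absurd (h3.trans this) (lt_irrefl _)

/-- The left end of a segment is not an interior point of `Γ`, apart from the cut point. -/
theorem valley_notMem (h : E.IsFirstReturnMap L M Γ x₀) {α β : A}
    (hα : E.scheme (α, Side.e) = (β, Side.b)) :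
    (E.x (β, Side.b) : AddCircle L) ∉ interior Γ \ {(x₀ : AddCircle L)} := by
  rintro ⟨h1, h2⟩
  set l := E.x (β, Side.b) with hl
  have hlU := h.beginInterval_subset β (h.begin_mem β)
  have hlt : x₀ < l := lt_of_le_of_ne hlU.1.1 fun heq => h2 (by rw [heq]; rfl)
  have hnhds : ∀ᶠ t : ℝ in nhdsWithin l (Set.Iio l), t ∈ ⋃ γ, E.beginInterval γ ∩ Set.Iio l := by
    have e1 : ∀ᶠ t : ℝ in nhds l, (t : AddCircle L) ∈ interior Γ :=
      (AddCircle.continuous_mk' L).continuousAt.eventually (isOpen_interior.mem_nhds h1)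
    filter_upwards [nhdsWithin_le_nhds e1, nhdsWithin_le_nhds (lt_mem_nhds hlt),
      self_mem_nhdsWithin] with t ht1 ht2 ht3
    have : t ∈ circleLift L Γ x₀ :=
      ⟨⟨le_of_lt ht2, (Set.mem_Iio.1 ht3).trans hlU.1.2⟩, interior_subset ht1⟩
    rw [← h.phaseSpace] at this
    obtain ⟨γ, hγ⟩ := Set.mem_iUnion.1 this
    exact Set.mem_iUnion.2 ⟨γ, hγ, ht3⟩
  have hcl : l ∈ closure (⋃ γ, E.beginInterval γ ∩ Set.Iio l) :=
    mem_closure_of_frequently_of_tendsto hnhds.frequently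
      (Filter.tendsto_id.mono_left nhdsWithin_le_nhds)
  rw [closure_iUnion_of_finite] at hcl
  obtain ⟨γ, hγ⟩ := Set.mem_iUnion.1 hcl
  obtain ⟨t, ht⟩ := closure_nonempty_iff.1 ⟨l, hγ⟩
  have hγlt : E.x (γ, Side.b) < l := ht.1.1.trans_lt ht.2
  have hc := h.sameCycle_of_mem (subset_closure (h.begin_mem β))
    (closure_mono Set.inter_subset_left hγ)
  have := h.rises.valley_lt h.uniquePeaks hα hc (fun heq => by simp [heq, hl] at hγlt)
  exact absurd (this.trans hγlt) (lt_irrefl _)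

theorem inner_end_mem (hL : 0 < L) (h : E.IsFirstReturnMap L M Γ x₀) {α β : A}
    (hα : E.scheme (α, Side.e) = (β, Side.e)) :
    (E.x (β, Side.e) : AddCircle L) ∈ interior Γ \ {(x₀ : AddCircle L)} := by
  have hdown := h.rises.down α
  rw [hα] at hdown
  refine inner_mem hL (a := E.x (E.scheme (β, Side.e))) (b := E.x (α, Side.e)) ?_
    ⟨h.rises.down β, hdown⟩
  rintro t ⟨ht1, ht2⟩
  rcases lt_or_ge t (E.x (β, Side.e)) with h1 | h1
  · exact h.endInterval_subset β ⟨ht1.le, h1⟩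
  · exact h.endInterval_subset α ⟨by rwa [hα], ht2⟩

/-- The set of possible positions of the next visit of the inner part of `Γ`, where the position
itself counts for ending elements only. Each dual cycle has a single such position, namely the
upper end of a piece of a trajectory. -/
def nextInner (E : IRE A) (L M : ℝ) (V : Set (AddCircle L)) : A × Side → Set (AddCircle L)
  | (α, Side.b) => {q | FirstReturnsTo (circleRotation L M) V (E.x (α, Side.b)) q}
  | (α, Side.e) => {q | ((E.x (α, Side.e) : AddCircle L) ∈ V ∧ q = E.x (α, Side.e)) ∨
      ((E.x (α, Side.e) : AddCircle L) ∉ V ∧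
        FirstReturnsTo (circleRotation L M) V (E.x (α, Side.e)) q)}

/-- Before the return time of a label, the trajectories of the endpoints of its beginning interval
avoid the inner part of `Γ`, and peaks and valleys of the cycles do not belong to it either. -/
theorem nextInner_dual (hL : 0 < L) (hM : IrrationalRotation L M)
    (h : E.IsFirstReturnMap L M Γ x₀) (ξ : A × Side) :
    nextInner E L M (interior Γ \ {(x₀ : AddCircle L)}) (E.scheme.dual ξ) =
      nextInner E L M (interior Γ \ {(x₀ : AddCircle L)}) ξ := by
  have : Fact (0 < L) := ⟨hL⟩
  obtain ⟨α, s⟩ := ξ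
  obtain ⟨n, hn, hnM, hret⟩ := h.exists_returnTime hL hM α
  set V := interior Γ \ {(x₀ : AddCircle L)} with hV
  have hVopen : IsOpen V := isOpen_interior.sdiff isClosed_singleton
  rcases s with _ | _
  · have hav : ∀ i : ℕ, 1 ≤ i → i < n →
        (circleRotation L M)^[i] (E.x (α, Side.b)) ∉ V := by
      intro i hi hi' hmem
      rw [iterate_circleRotation] at hmem
      exact (hret _ (h.begin_mem α)).2 i hi hi' (interior_subset hmem.1)
    have hit : (circleRotation L M)^[n] (E.x (α, Side.b)) =
        (E.x (E.scheme (α, Side.e)) : AddCircle L) := by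
      rw [iterate_circleRotation, hnM, ← AddCircle.coe_add, displacement]
      ring_nf
    have key := firstReturnsTo_iff_of_avoids hn hav
    rw [hit] at key
    rw [Scheme.dual_b]
    rcases hη : E.scheme (α, Side.e) with ⟨β, _ | _⟩
    · have hnot : (E.x (β, Side.b) : AddCircle L) ∉ V := h.valley_notMem hη
      ext q
      simp only [nextInner, Set.mem_ofPred_eq]
      rw [key, hη]
      simp [hnot]
    · ext q
      simp only [nextInner, Set.mem_ofPred_eq]
      rw [key, hη]
  · have hav : ∀ i : ℕ, 1 ≤ i → i < n →
        (circleRotation L M)^[i] (E.x (E.scheme (α, Side.b))) ∉ V := by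
      intro i hi hi' hmem
      rw [iterate_circleRotation] at hmem
      have hcont : Continuous fun t : ℝ => (t : AddCircle L) + i • (M : AddCircle L) :=
        (AddCircle.continuous_mk' L).add continuous_const
      have e1 : ∀ᶠ t : ℝ in nhds (E.x (E.scheme (α, Side.b))),
          (t : AddCircle L) + i • (M : AddCircle L) ∈ V :=
        hcont.continuousAt.eventually (hVopen.mem_nhds hmem)
      obtain ⟨t, ht1, ht2⟩ := ((e1.filter_mono nhdsWithin_le_nhds).and
        (Ioo_mem_nhdsLT (h.rises.up α))).exists
      exact (hret t ⟨ht2.1.le, ht2.2⟩).2 i hi hi' (interior_subset ht1.1)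
    have hit : (circleRotation L M)^[n] (E.x (E.scheme (α, Side.b))) =
        (E.x (α, Side.e) : AddCircle L) := by
      rw [iterate_circleRotation, hnM, ← AddCircle.coe_add, ← end_eq]
    have key := firstReturnsTo_iff_of_avoids hn hav
    rw [hit] at key
    rw [Scheme.dual_e]
    rcases hη : E.scheme (α, Side.b) with ⟨β, _ | _⟩
    · ext q
      rw [hη] at key
      simp only [nextInner, Set.mem_ofPred_eq]
      rw [key]
    · have hnot : (E.x (β, Side.e) : AddCircle L) ∉ V := h.peak_notMem hη
      rw [hη] at key
      ext q
      simp only [nextInner, Set.mem_ofPred_eq]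
      rw [key]
      simp [hnot]

/-- At a peak of a dual cycle, the next visit of the inner part is the left end of the ending
interval of the label, which determines this label. -/
theorem dual_uniquePeaks (hL : 0 < L) (hM : IrrationalRotation L M)
    (h : E.IsFirstReturnMap L M Γ x₀) : E.scheme.dual.UniquePeaks := by
  have : Fact (0 < L) := ⟨hL⟩
  intro α α' γ γ' h1 h2 hc
  set V := interior Γ \ {(x₀ : AddCircle L)} with hV
  have hend : ∀ α γ, E.scheme.dual (α, Side.b) = (γ, Side.e) →
      nextInner E L M V (α, Side.b) = {(E.x (E.scheme (α, Side.e)) : AddCircle L)} := by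
    intro α γ hαγ
    rw [← h.nextInner_dual hL hM, hαγ]
    rw [Scheme.dual_b] at hαγ
    have : (E.x (γ, Side.e) : AddCircle L) ∈ V := h.inner_end_mem hL hαγ
    ext q
    simp only [nextInner, Set.mem_ofPred_eq, Set.mem_singleton_iff]
    rw [hαγ]
    refine ⟨?_, fun hq => Or.inl ⟨this, hq⟩⟩
    rintro (⟨-, hq⟩ | ⟨hq, -⟩)
    · exact hq
    · exact absurd this hq
  have heq := Equiv.Perm.SameCycle.eq_of_invariant (h.nextInner_dual hL hM) hc
  rw [hend α γ h1, hend α' γ' h2, Set.singleton_eq_singleton_iff] at heq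
  have m1 : E.x (E.scheme (α, Side.e)) ∈
      Set.Ico (E.x (E.scheme (α, Side.e))) (E.x (α, Side.e)) := ⟨le_rfl, h.rises.down α⟩
  have m2 : E.x (E.scheme (α', Side.e)) ∈
      Set.Ico (E.x (E.scheme (α', Side.e))) (E.x (α', Side.e)) := ⟨le_rfl, h.rises.down α'⟩
  have hx := (AddCircle.coe_eq_coe_iff_of_mem_Ico (h.endInterval_subset α m1).1
    (h.endInterval_subset α' m2).1).1 heq
  have m2 : E.x (E.scheme (α, Side.e)) ∈
      Set.Ico (E.x (E.scheme (α', Side.e))) (E.x (α', Side.e)) := hx ▸ m2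
  obtain ⟨δ, h3, h4⟩ := h.rises.exists_begin m1
  obtain ⟨δ', h5, h6⟩ := h.rises.exists_begin m2
  have h7 := h.sameCycle_of_mem (subset_closure h4) (subset_closure h6)
  exact h.rises.end_unique h.uniquePeaks (h3.trans (h7.trans h5.symm)) m1 m2

/-- The part of `Γ` over an invariant set of labels traps every trajectory that starts there, while
trajectories are dense. -/
theorem irreducible (hL : 0 < L) (hM : IrrationalRotation L M)
    (h : E.IsFirstReturnMap L M Γ x₀) : E.scheme.Irreducible := by
  have : Fact (0 < L) := ⟨hL⟩
  intro A₀ hA₀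
  by_contra! hcon
  obtain ⟨⟨α, hα⟩, hne⟩ := hcon
  obtain ⟨β, hβ⟩ := (Set.ne_univ_iff_exists_notMem _).1 hne
  have hinv : ∀ ξ η : A × Side, E.scheme.SameCycle ξ η → ξ.1 ∈ A₀ → η.1 ∈ A₀ := by
    intro ξ η hξη hξ
    obtain ⟨n, rfl⟩ := hξη.exists_nat_pow_eq
    have : ∀ n : ℕ, (E.scheme ^ n) ξ ∈ Scheme.doubled A₀ := by
      intro n
      induction n with
      | zero => exact hξ
      | succ n ih =>
        rw [pow_succ', Equiv.Perm.mul_apply, ← hA₀]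
        exact ⟨_, ih, rfl⟩
    exact this n
  choose n hn hnM hret using h.exists_returnTime hL hM
  -- every visit of `Γ` by a trajectory that starts over `A₀` is over `A₀`
  have key : ∀ k : ℕ, ∀ γ ∈ A₀, ∀ t ∈ E.beginInterval γ,
      (t : AddCircle L) + k • (M : AddCircle L) ∈ Γ →
      ∃ δ ∈ A₀, ∃ s ∈ E.beginInterval δ,
        (s : AddCircle L) = (t : AddCircle L) + k • (M : AddCircle L) := by
    intro k
    induction k using Nat.strong_induction_on with
    | _ k ih =>
      intro γ hγ t ht hk
      rcases Nat.eq_zero_or_pos k with rfl | hpos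
      · exact ⟨γ, hγ, t, ht, by simp⟩
      have hnk : n γ ≤ k := by
        by_contra! hlt
        exact (hret γ t ht).2 k hpos hlt hk
      have hs : t + E.displacement γ ∈
          Set.Ico (E.x (E.scheme (γ, Side.e))) (E.x (γ, Side.e)) := by
        rw [end_eq, displacement]
        exact ⟨by linarith [ht.1], by linarith [ht.2]⟩
      obtain ⟨δ, h1, h2⟩ := h.rises.exists_begin hs
      have e1 : ((t + E.displacement γ : ℝ) : AddCircle L) + (k - n γ) • (M : AddCircle L) =
          (t : AddCircle L) + k • (M : AddCircle L) := by
        rw [AddCircle.coe_add, ← hnM, add_assoc, ← add_nsmul, Nat.add_sub_cancel' hnk]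
      obtain ⟨δ', h3, s, h4, h5⟩ := ih (k - n γ) (by have := hn γ; omega) δ
        (hinv (γ, Side.e) (δ, Side.b) h1 hγ) _ h2 (by rw [e1]; exact hk)
      exact ⟨δ', h3, s, h4, h5.trans e1⟩
  obtain ⟨k, -, hk⟩ := hM.exists_nsmul_mem hL (E.x (α, Side.b) : AddCircle L)
    (V := (fun s : ℝ => (s : AddCircle L)) ''
      Set.Ioo (E.x (β, Side.b)) (E.x (E.scheme (β, Side.b))))
    (QuotientAddGroup.isOpenMap_coe _ isOpen_Ioo) ((Set.nonempty_Ioo.2 (h.rises.up β)).image _)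
  obtain ⟨t, ht, htk⟩ := hk
  have ht' : t ∈ E.beginInterval β := ⟨ht.1.le, ht.2⟩
  have htU := h.beginInterval_subset β ht'
  simp only at htk
  obtain ⟨δ, h1, s, h2, h3⟩ := key k α hα _ (h.begin_mem α) (by rw [← htk]; exact htU.2)
  have hst := (AddCircle.coe_eq_coe_iff_of_mem_Ico (h.beginInterval_subset δ h2).1 htU.1).1
    (h3.trans htk.symm)
  subst hst
  rw [h.eq_of_mem h2 ht'] at h1
  exact hβ h1

theorem isRotational (hL : 0 < L) (hM : IrrationalRotation L M)
    (h : E.IsFirstReturnMap L M Γ x₀) : E.IsRotational :=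
  ⟨h.1, h.1.2, (h.dual_positive hL hM).isIntervalExchange (h.dual_uniquePeaks hL hM)⟩

end IsFirstReturnMap

end IRE

/-! ### Interval exchanges from two partitions -/

section Partition

/-- If a half-open interval is covered by finitely many half-open intervals, one of them
accumulates at its right end from the left. -/
theorem exists_mem_Ioc_of_Ico_subset {ι : Type*} [Finite ι] {f g : ι → ℝ} {c r : ℝ} (hc : c < r)
    (h : Set.Ico c r ⊆ ⋃ i, Set.Ico (f i) (g i)) : ∃ i, r ∈ Set.Ioc (f i) (g i) := by
  have hcl : r ∈ closure (⋃ i, Set.Ico (f i) (g i) ∩ Set.Iio r) := by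
    have h1 : r ∈ closure (Set.Ico c r) := by
      rw [closure_Ico hc.ne]; exact ⟨hc.le, le_rfl⟩
    refine closure_mono (fun t ht => ?_) h1
    obtain ⟨i, hi⟩ := Set.mem_iUnion.1 (h ht)
    exact Set.mem_iUnion.2 ⟨i, hi, ht.2⟩
  rw [closure_iUnion_of_finite] at hcl
  obtain ⟨i, hi⟩ := Set.mem_iUnion.1 hcl
  obtain ⟨t, ht⟩ := closure_nonempty_iff.1 ⟨r, hi⟩
  refine ⟨i, ht.1.1.trans_lt ht.2, ?_⟩
  have h2 : closure (Set.Ico (f i) (g i) ∩ Set.Iio r) ⊆ Set.Iic (g i) :=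
    closure_minimal (fun t ht => ht.1.2.le) isClosed_Iic
  exact h2 hi

/-- If an open interval is covered by finitely many closed intervals, one of them
accumulates at its left end from the right. -/
theorem exists_mem_Ico_of_Ioo_subset {ι : Type*} [Finite ι] {f g : ι → ℝ} {c r : ℝ} (hc : r < c)
    (h : Set.Ioo r c ⊆ ⋃ i, Set.Icc (f i) (g i)) : ∃ i, r ∈ Set.Ico (f i) (g i) := by
  have hcl : r ∈ closure (⋃ i, Set.Icc (f i) (g i) ∩ Set.Ioi r) := by
    have h1 : r ∈ closure (Set.Ioo r c) := by
      rw [closure_Ioo hc.ne]; exact ⟨le_rfl, hc.le⟩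
    refine closure_mono (fun t ht => ?_) h1
    obtain ⟨i, hi⟩ := Set.mem_iUnion.1 (h ht)
    exact Set.mem_iUnion.2 ⟨i, hi, ht.1⟩
  rw [closure_iUnion_of_finite] at hcl
  obtain ⟨i, hi⟩ := Set.mem_iUnion.1 hcl
  obtain ⟨t, ht⟩ := closure_nonempty_iff.1 ⟨r, hi⟩
  refine ⟨i, ?_, lt_of_lt_of_le ht.2 ht.1.2⟩
  have h2 : closure (Set.Icc (f i) (g i) ∩ Set.Ioi r) ⊆ Set.Ici (f i) :=
    closure_minimal (fun t ht => ht.1.1) isClosed_Ici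
  exact h2 hi

variable {ι : Type u} {a l τ : ι → ℝ}

theorem eq_of_disjoint_Ico (hl : ∀ i, 0 < l i)
    (hI : ∀ i j t, t ∈ Set.Ico (a i) (a i + l i) → t ∈ Set.Ico (a j) (a j + l j) → i = j)
    {i j : ι} (h : a i + l i = a j + l j) : i = j :=
  hI i j (max (a i) (a j)) ⟨le_max_left _ _, max_lt (by linarith [hl i]) (by linarith [hl j])⟩
    ⟨le_max_right _ _, max_lt (by linarith [hl i]) (by linarith [hl j])⟩

/-- The successor relation of the scheme that is built from the intervals `[a i, a i + l i)` and
their translates `[τ i, τ i + l i)`. A beginning element is followed by a beginning element and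
an ending element by an ending element as long as this is possible. -/
def PartitionSucc (a l τ : ι → ℝ) : ι × Side → ι × Side → Prop
  | (i, Side.b), (k, Side.b) => a k = a i + l i
  | (i, Side.b), (k, Side.e) => (a i + l i ∉ ⋃ j, Set.Ico (a j) (a j + l j)) ∧
      τ k + l k = a i + l i
  | (i, Side.e), (k, Side.e) => τ k + l k = τ i
  | (i, Side.e), (k, Side.b) => (∀ j, τ j + l j ≠ τ i) ∧ a k = τ i

/-- Two partitions of the same subset of the line into half-open intervals, the second one
consisting of translates of the intervals of the first one, define an interval exchange. -/
theorem exists_intervalExchange [Finite ι] (hl : ∀ i, 0 < l i)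
    (hI : ∀ i j t, t ∈ Set.Ico (a i) (a i + l i) → t ∈ Set.Ico (a j) (a j + l j) → i = j)
    (hJ : ∀ i j t, t ∈ Set.Ico (τ i) (τ i + l i) → t ∈ Set.Ico (τ j) (τ j + l j) → i = j)
    (hU : ⋃ i, Set.Ico (a i) (a i + l i) = ⋃ i, Set.Ico (τ i) (τ i + l i))
    (hb : ∀ i, a i + l i ∈ ⋃ i, Set.Ico (a i) (a i + l i) → ∃ k, a k = a i + l i)
    (he : ∀ i, (∀ j, τ j + l j ≠ τ i) → ∃ k, a k = τ i) :
    ∃ E : IRE ι, E.IsIntervalExchange ∧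
      (∀ ξ η, ¬ E.scheme.SameCycle ξ η → Disjoint (closure (E.segment ξ)) (closure (E.segment η))) ∧
      (∀ i, E.beginInterval i = Set.Ico (a i) (a i + l i)) ∧
      (∀ i, E.x (i, Side.b) = a i) ∧ ∀ i, E.x (E.scheme (i, Side.e)) = τ i := by
  set U := ⋃ i, Set.Ico (a i) (a i + l i) with hUdef
  have hIU : ∀ i, Set.Ico (a i) (a i + l i) ⊆ U := fun i =>
    Set.subset_iUnion (fun i => Set.Ico (a i) (a i + l i)) i
  have hJU : ∀ i, Set.Ico (τ i) (τ i + l i) ⊆ U := fun i => by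
    rw [hU]; exact Set.subset_iUnion (fun i => Set.Ico (τ i) (τ i + l i)) i
  have htail : ∀ i, ∃ j, a i + l i ∈ Set.Ioc (τ j) (τ j + l j) := fun i =>
    exists_mem_Ioc_of_Ico_subset (by linarith [hl i] : a i < a i + l i)
      ((hIU i).trans hU.le)
  have hex : ∀ ξ, ∃ η, PartitionSucc a l τ ξ η := by
    rintro ⟨i, _ | _⟩
    · by_cases h : a i + l i ∈ U
      · obtain ⟨k, hk⟩ := hb i h
        exact ⟨(k, Side.b), hk⟩
      · obtain ⟨j, hj⟩ := htail i
        refine ⟨(j, Side.e), h, ?_⟩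
        by_contra hne
        exact h (hJU j ⟨hj.1.le, lt_of_le_of_ne hj.2 (Ne.symm hne)⟩)
    · by_cases h : ∀ j, τ j + l j ≠ τ i
      · obtain ⟨k, hk⟩ := he i h
        exact ⟨(k, Side.b), h, hk⟩
      · push Not at h
        obtain ⟨j, hj⟩ := h
        exact ⟨(j, Side.e), hj⟩
  choose s hs using hex
  have hmixed : ∀ i i', a i + l i = τ i' → ∃ j, τ j + l j = τ i' := by
    intro i i' h
    obtain ⟨j, hj⟩ := htail i
    rw [h] at hj
    refine ⟨j, ?_⟩
    by_contra hne
    have := hJ j i' (τ i') ⟨hj.1.le, lt_of_le_of_ne hj.2 (Ne.symm hne)⟩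
      ⟨le_rfl, by linarith [hl i']⟩
    subst this
    exact lt_irrefl _ hj.1
  have hinj : Function.Injective s := by
    intro ξ ξ' h
    have h1 := hs ξ
    have h2 := hs ξ'
    rw [← h] at h2
    obtain ⟨i, _ | _⟩ := ξ <;> obtain ⟨i', _ | _⟩ := ξ' <;>
      rcases hη : s (i, _) with ⟨k, _ | _⟩ <;> rw [hη] at h1 h2 <;>
      simp only [PartitionSucc] at h1 h2
    · rw [eq_of_disjoint_Ico hl hI (h1.symm.trans h2)]
    · rw [eq_of_disjoint_Ico hl hI (h1.2.symm.trans h2.2)]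
    · obtain ⟨j, hj⟩ := hmixed i i' (h1.symm.trans h2.2)
      exact absurd hj (h2.1 j)
    · rw [← h1.2, h2] at h1
      exact absurd (hJU i' ⟨le_rfl, by linarith [hl i']⟩) h1.1
    · obtain ⟨j, hj⟩ := hmixed i' i (h2.symm.trans h1.2)
      exact absurd hj (h1.1 j)
    · rw [← h2.2, h1] at h2
      exact absurd (hJU i ⟨le_rfl, by linarith [hl i]⟩) h2.1
    · rw [hJ i i' (τ i) ⟨le_rfl, by linarith [hl i]⟩
        ⟨by rw [← h1.2, ← h2.2], by rw [← h1.2, h2.2]; linarith [hl i']⟩]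
    · rw [hJ i i' (τ i) ⟨le_rfl, by linarith [hl i]⟩
        ⟨by rw [← h1, ← h2], by rw [← h1, h2]; linarith [hl i']⟩]
  let σ : Scheme ι := Equiv.ofBijective s (Finite.injective_iff_bijective.1 hinj)
  have hσ : ∀ ξ, PartitionSucc a l τ ξ (σ ξ) := hs
  let x : ι × Side → ℝ := fun ξ => match ξ with
    | (i, Side.b) => a i
    | (i, Side.e) => τ i + l i
  have hxb : ∀ i, x (i, Side.b) = a i := fun i => rfl
  have hxe : ∀ i, x (i, Side.e) = τ i + l i := fun i => rfl
  have hxσb : ∀ i, x (σ (i, Side.b)) = a i + l i := by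
    intro i
    have := hσ (i, Side.b)
    rcases hη : σ (i, Side.b) with ⟨k, _ | _⟩ <;> rw [hη] at this
    · exact this
    · exact this.2
  have hxσe : ∀ i, x (σ (i, Side.e)) = τ i := by
    intro i
    have := hσ (i, Side.e)
    rcases hη : σ (i, Side.e) with ⟨k, _ | _⟩ <;> rw [hη] at this
    · exact this.2
    · exact this
  have hallow : σ.Allows x := fun i => by rw [hxσb, hxσe, hxb, hxe]; ring
  have hpos : ∀ i, 0 < x (σ (i, Side.b)) - x (i, Side.b) := fun i => by
    rw [hxσb, hxb]; linarith [hl i]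
  -- the components of the closure of `U` are invariants of the cycles
  have hV : closure U = ⋃ i, Set.Icc (a i) (a i + l i) := by
    rw [hUdef, closure_iUnion_of_finite]
    exact Set.iUnion_congr fun i => closure_Ico (by linarith [hl i])
  have hcomp : ∀ ξ, connectedComponentIn (closure U) (x (σ ξ)) =
      connectedComponentIn (closure U) (x ξ) := by
    have aux : ∀ c d : ℝ, c < d → Set.Ico c d ⊆ U →
        connectedComponentIn (closure U) c = connectedComponentIn (closure U) d := by
      intro c d hcd h
      have h1 : Set.Icc c d ⊆ closure U := by
        rw [← closure_Ico hcd.ne]; exact closure_mono h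
      exact connectedComponentIn_eq (isPreconnected_Icc.subset_connectedComponentIn
        (Set.left_mem_Icc.2 hcd.le) h1 (Set.right_mem_Icc.2 hcd.le))
    rintro ⟨i, _ | _⟩
    · rw [hxσb, hxb]
      exact (aux _ _ (by linarith [hl i]) (hIU i)).symm
    · rw [hxσe, hxe]
      exact aux _ _ (by linarith [hl i]) (hJU i)
  have hcomp' : ∀ ξ η, σ.SameCycle ξ η → connectedComponentIn (closure U) (x ξ) =
      connectedComponentIn (closure U) (x η) :=
    fun ξ η hξη => Equiv.Perm.SameCycle.eq_of_invariant
      (h := fun ξ => connectedComponentIn (closure U) (x ξ)) hcomp hξη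
  have hnlt : ∀ i i', a i + l i ∉ U → connectedComponentIn (closure U) (a i + l i) =
      connectedComponentIn (closure U) (a i' + l i') → ¬ a i + l i < a i' + l i' := by
    intro i i' h1 h2 hlt
    have hmem : ∀ i, a i + l i ∈ connectedComponentIn (closure U) (a i + l i) := fun i => by
      refine mem_connectedComponentIn ?_
      rw [hV]
      exact Set.mem_iUnion.2 ⟨i, by linarith [hl i], le_rfl⟩
    have hsub := (isPreconnected_connectedComponentIn (x := a i + l i)
      (F := closure U)).Icc_subset (hmem i) (by rw [h2]; exact hmem i')
    obtain ⟨j, hj⟩ := exists_mem_Ico_of_Ioo_subset hlt (f := a) (g := fun i => a i + l i) (by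
      rw [← hV]
      exact (Set.Ioo_subset_Icc_self.trans hsub).trans (connectedComponentIn_subset _ _))
    exact h1 (hIU j hj)
  have hpk : σ.UniquePeaks := by
    intro i i' k k' h1 h2 hc
    have e1 := hσ (i, Side.b)
    have e2 := hσ (i', Side.b)
    rw [h1] at e1
    rw [h2] at e2
    have e3 := hcomp' _ _ ((Equiv.Perm.sameCycle_apply_left.2
      (Equiv.Perm.sameCycle_apply_right.2 hc)))
    rw [hxσb, hxσb] at e3
    exact eq_of_disjoint_Ico hl hI (le_antisymm (not_lt.1 (hnlt i' i e2.1 e3.symm))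
      (not_lt.1 (hnlt i i' e1.1 e3)))
  let E : IRE ι := ⟨σ, x, hallow⟩
  have hbegin : ∀ i, E.beginInterval i = Set.Ico (a i) (a i + l i) := by
    intro i
    change Set.Ico (x (i, Side.b)) (x (σ (i, Side.b))) = _
    rw [hxσb]
  have htouch : ∀ i j, a i + l i = a j → σ (i, Side.b) = (j, Side.b) := by
    intro i j hij
    have e1 := hσ (i, Side.b)
    rcases hη : σ (i, Side.b) with ⟨k, _ | _⟩ <;> rw [hη] at e1
    · have e2 : a k = a j := Eq.trans e1 hij
      rw [hI k j (a k) ⟨le_rfl, by linarith [hl k]⟩ ⟨e2.ge, by linarith [hl j]⟩]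
    · refine absurd (hIU j ?_) e1.1
      rw [hij]
      exact ⟨le_rfl, by linarith [hl j]⟩
  refine ⟨E, ⟨hpos, Scheme.Positive.isIntervalExchange ⟨x, hallow, hpos⟩ hpk⟩, ?_, hbegin, hxb,
    hxσe⟩
  intro ξ η hξη
  have hclos : ∀ ζ, closure (E.segment ζ) ⊆
      ⋃ i ∈ {i : ι | σ.SameCycle ζ (i, Side.b)}, Set.Icc (a i) (a i + l i) := by
    intro ζ
    rw [IRE.segment, (Set.toFinite _).closure_biUnion]
    refine Set.iUnion₂_mono fun i _ => ?_
    rw [hbegin, closure_Ico (by linarith [hl i])]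
  rw [Set.disjoint_left]
  intro t ht1 ht2
  obtain ⟨i, hi, hti⟩ := Set.mem_iUnion₂.1 (hclos ξ ht1)
  obtain ⟨j, hj, htj⟩ := Set.mem_iUnion₂.1 (hclos η ht2)
  have hij : σ.SameCycle (i, Side.b) (j, Side.b) := by
    have hstep : ∀ i j, a i + l i = a j → σ.SameCycle (i, Side.b) (j, Side.b) := by
      intro i j h
      rw [← htouch i j h]
      simp [Equiv.Perm.SameCycle.refl]
    rcases hti.2.lt_or_eq with h1 | h1
    · rcases htj.2.lt_or_eq with h2 | h2
      · rw [hI i j t ⟨hti.1, h1⟩ ⟨htj.1, h2⟩]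
      · rcases hti.1.lt_or_eq with h3 | h3
        · rw [hI i j (max (a i) (a j)) ⟨le_max_left _ _, max_lt (by linarith [hl i])
            (by linarith [hl j])⟩ ⟨le_max_right _ _, max_lt (by linarith) (by linarith [hl j])⟩]
        · exact (hstep j i (by linarith)).symm
    · rcases htj.1.lt_or_eq with h3 | h3
      · rw [hI i j (max (a i) (a j)) ⟨le_max_left _ _, max_lt (by linarith [hl i])
          (by linarith)⟩
          ⟨le_max_right _ _, max_lt (by linarith [htj.2, hl i]) (by linarith [hl j])⟩]
      · exact hstep i j (by linarith)
  exact hξη (hi.trans (hij.trans hj.symm))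

end Partition

/-! ### First return maps are interval exchanges -/

section Existence

variable {L M : ℝ} {Γ : Set (AddCircle L)}

theorem coe_mem_circleArc_iff {a b t : ℝ} :
    (t : AddCircle L) ∈ circleArc L a b ↔ ∃ k : ℤ, t + k * L ∈ Set.Ico a b := by
  constructor
  · rintro ⟨s, hs, hst⟩
    have h0 : ((s - t : ℝ) : AddCircle L) = 0 := by
      rw [AddCircle.coe_sub]
      exact sub_eq_zero.2 hst
    obtain ⟨k, hk⟩ := AddCircle.coe_eq_zero_iff L |>.1 h0
    refine ⟨k, ?_⟩
    rw [zsmul_eq_mul] at hk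
    rw [hk, add_sub_cancel]
    exact hs
  · rintro ⟨k, hk⟩
    refine ⟨_, hk, ?_⟩
    simp only [AddCircle.coe_add, add_eq_left]
    rw [AddCircle.coe_eq_zero_iff]
    exact ⟨k, by simp⟩

/-- The endpoints of the arcs are the only places where membership in their union changes. -/
theorem IsUnionOfArcs.exists_boundary (hΓ : IsUnionOfArcs L Γ) (x₀ : ℝ) :
    ∃ B : Set (AddCircle L), B.Finite ∧ (x₀ : AddCircle L) ∈ B ∧
      ∀ a b : ℝ, (∀ t ∈ Set.Ioo a b, (t : AddCircle L) ∉ B) → ∀ t ∈ Set.Ico a b,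
        ((t : AddCircle L) ∈ Γ ↔ (a : AddCircle L) ∈ Γ) := by
  obtain ⟨s, -, -, rfl⟩ := hΓ
  refine ⟨insert (x₀ : AddCircle L) ((fun p : ℝ × ℝ => (p.1 : AddCircle L)) '' s ∪
    (fun p : ℝ × ℝ => (p.2 : AddCircle L)) '' s), ?_, Set.mem_insert _ _, ?_⟩
  · exact Set.Finite.insert _ ((s.finite_toSet.image _).union (s.finite_toSet.image _))
  intro a b hB t ht
  have hshift : ∀ (k : ℤ) (c : ℝ), ((c - k * L : ℝ) : AddCircle L) = c := by
    intro k c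
    rw [AddCircle.coe_sub, sub_eq_self, AddCircle.coe_eq_zero_iff]
    exact ⟨k, by simp⟩
  simp only [Set.mem_iUnion₂, coe_mem_circleArc_iff]
  refine exists_congr fun p => exists_congr fun hp => exists_congr fun k => ?_
  have h1 : ¬ (a < p.1 - k * L ∧ p.1 - k * L ≤ t) := fun h =>
    hB (p.1 - k * L) ⟨h.1, h.2.trans_lt ht.2⟩ (by
      rw [hshift]; exact Or.inr (Or.inl ⟨p, hp, rfl⟩))
  have h2 : ¬ (a < p.2 - k * L ∧ p.2 - k * L ≤ t) := fun h =>
    hB (p.2 - k * L) ⟨h.1, h.2.trans_lt ht.2⟩ (by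
      rw [hshift]; exact Or.inr (Or.inr ⟨p, hp, rfl⟩))
  have h3 := ht.1
  simp only [Set.mem_Ico]
  constructor
  · rintro ⟨h4, h5⟩
    exact ⟨by by_contra! h6; exact h1 ⟨by linarith, by linarith⟩, by linarith⟩
  · rintro ⟨h4, h5⟩
    exact ⟨by linarith, by by_contra! h6; exact h2 ⟨by linarith, by linarith⟩⟩

theorem IsUnionOfArcs.exists_isOpen (hΓ : IsUnionOfArcs L Γ) :
    ∃ V ⊆ Γ, IsOpen V ∧ V.Nonempty := by
  obtain ⟨s, ⟨p, hp⟩, h, rfl⟩ := hΓ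
  refine ⟨(fun t : ℝ => (t : AddCircle L)) '' Set.Ioo p.1 p.2, ?_,
    QuotientAddGroup.isOpenMap_coe _ isOpen_Ioo, (Set.nonempty_Ioo.2 (h p hp).1).image _⟩
  exact (Set.image_mono Set.Ioo_subset_Ico_self).trans
    (Set.subset_biUnion_of_mem (u := fun p : ℝ × ℝ => circleArc L p.1 p.2) hp)

/-- The return times of an irrational rotation to an open set are bounded. -/
theorem IrrationalRotation.exists_bound (hL : 0 < L) (hM : IrrationalRotation L M)
    {V : Set (AddCircle L)} (hV : IsOpen V) (hne : V.Nonempty) :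
    ∃ N : ℕ, ∀ p : AddCircle L, ∃ n : ℕ, 1 ≤ n ∧ n ≤ N ∧ p + n • (M : AddCircle L) ∈ V := by
  have : Fact (0 < L) := ⟨hL⟩
  obtain ⟨F, hF⟩ := isCompact_univ.elim_finite_subcover
    (fun n : ℕ => {p : AddCircle L | p + (n + 1) • (M : AddCircle L) ∈ V})
    (fun n => hV.preimage (by fun_prop : Continuous fun p : AddCircle L =>
      p + (n + 1) • (M : AddCircle L)))
    (fun p _ => by
      obtain ⟨n, hn, hnV⟩ := hM.exists_nsmul_mem hL p hV hne
      refine Set.mem_iUnion.2 ⟨n - 1, ?_⟩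
      simpa [Nat.sub_add_cancel hn] using hnV)
  refine ⟨F.sup id + 1, fun p => ?_⟩
  obtain ⟨n, hn, hnV⟩ := Set.mem_iUnion₂.1 (hF (Set.mem_univ p))
  exact ⟨n + 1, by omega, Nat.succ_le_succ (Finset.le_sup (f := id) hn), hnV⟩

theorem exists_lift_mem_Ico (hL : 0 < L) (x₀ : ℝ) (p : AddCircle L) :
    ∃ t ∈ Set.Ico x₀ (x₀ + L), (t : AddCircle L) = p := by
  have : Fact (0 < L) := ⟨hL⟩
  have := AddCircle.coe_image_Ico_eq L x₀
  exact (this.symm ▸ Set.mem_univ p : p ∈ (fun t : ℝ => (t : AddCircle L)) '' _)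

theorem finite_lifts (hL : 0 < L) (x₀ M : ℝ) {B : Set (AddCircle L)} (hB : B.Finite) (N : ℕ) :
    {t : ℝ | t ∈ Set.Ico x₀ (x₀ + L) ∧
      ∃ i ≤ N, (t : AddCircle L) + i • (M : AddCircle L) ∈ B}.Finite := by
  have : Fact (0 < L) := ⟨hL⟩
  have h : ∀ i ∈ Set.Iic N, {t : ℝ | t ∈ Set.Ico x₀ (x₀ + L) ∧
      (t : AddCircle L) + i • (M : AddCircle L) ∈ B}.Finite := by
    intro i _
    refine Set.Finite.of_finite_image (f := fun t : ℝ => (t : AddCircle L) + i • (M : AddCircle L))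
      (hB.subset ?_) ?_
    · rintro _ ⟨t, ht, rfl⟩
      exact ht.2
    · intro t ht s hs hts
      exact (AddCircle.coe_eq_coe_iff_of_mem_Ico ht.1 hs.1).1 (add_right_cancel hts)
  refine ((Set.finite_Iic N).biUnion h).subset ?_
  rintro t ⟨ht, i, hi, hiB⟩
  exact Set.mem_iUnion₂.2 ⟨i, hi, ht, hiB⟩

/-- The first return map of an irrational rotation to a union of arcs is an interval exchange. The
circle is cut at all points whose short trajectories meet the endpoints of the arcs. -/
theorem exists_isFirstReturnMap (hL : 0 < L) (hM : IrrationalRotation L M)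
    (hΓ : IsUnionOfArcs L Γ) (x₀ : ℝ) :
    ∃ (d : ℕ) (E : IRE (Fin d)), E.IsFirstReturnMap L M Γ x₀ := by
  have hfact : Fact (0 < L) := ⟨hL⟩
  obtain ⟨B, hBfin, hx₀B, hB⟩ := hΓ.exists_boundary x₀
  obtain ⟨V, hVΓ, hVopen, hVne⟩ := hΓ.exists_isOpen
  obtain ⟨N, hN⟩ := hM.exists_bound hL hVopen hVne
  set U := circleLift L Γ x₀ with hU
  set P := {t : ℝ | t ∈ Set.Ico x₀ (x₀ + L) ∧
      ∃ i ≤ N, (t : AddCircle L) + i • (M : AddCircle L) ∈ B} with hP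
  have hPfin : P.Finite := finite_lifts hL x₀ M hBfin N
  have hx₀P : x₀ ∈ P := ⟨⟨le_rfl, by linarith⟩, 0, Nat.zero_le _, by simpa using hx₀B⟩
  -- the next point of subdivision
  have hnext : ∀ p : ℝ, p < x₀ + L → ∃ r ∈ insert (x₀ + L) P, p < r ∧
      ∀ q ∈ insert (x₀ + L) P, p < q → r ≤ q := by
    intro p hp
    obtain ⟨r, hr, hr'⟩ := Set.exists_min_image {q | q ∈ insert (x₀ + L) P ∧ p < q} id
      ((hPfin.insert _).subset fun q hq => hq.1) ⟨x₀ + L, Set.mem_insert _ _, hp⟩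
    exact ⟨r, hr.1, hr.2, fun q hq hpq => hr' q ⟨hq, hpq⟩⟩
  have hprev : ∀ t ∈ Set.Ico x₀ (x₀ + L), ∃ p ∈ P, p ≤ t ∧ ∀ q ∈ P, q ≤ t → q ≤ p := by
    intro t ht
    obtain ⟨r, hr, hr'⟩ := Set.exists_max_image {q | q ∈ P ∧ q ≤ t} id
      (hPfin.subset fun q hq => hq.1) ⟨x₀, hx₀P, ht.1⟩
    exact ⟨r, hr.1, hr.2, fun q hq hqt => hr' q ⟨hq, hqt⟩⟩
  choose! nx hnx1 hnx2 hnx3 using hnext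
  have hnxle : ∀ p ∈ P, nx p ≤ x₀ + L := fun p hp => hnx3 p hp.1.2 _ (Set.mem_insert _ _) hp.1.2
  -- between neighbouring points of subdivision the short trajectories avoid `B`
  have hfree : ∀ p ∈ P, ∀ t ∈ Set.Ioo p (nx p), ∀ i ≤ N,
      (t : AddCircle L) + i • (M : AddCircle L) ∉ B := by
    intro p hp t ht i hi hmem
    have : t ∈ P := ⟨⟨hp.1.1.trans ht.1.le, ht.2.trans_le (hnxle p hp)⟩, i, hi, hmem⟩
    exact absurd (hnx3 p hp.1.2 t (Set.mem_insert_of_mem _ this) ht.1) (not_le.2 ht.2)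
  have hconst : ∀ p ∈ P, ∀ t ∈ Set.Ico p (nx p), ∀ i ≤ N,
      ((t : AddCircle L) + i • (M : AddCircle L) ∈ Γ ↔
        (p : AddCircle L) + i • (M : AddCircle L) ∈ Γ) := by
    intro p hp t ht i hi
    have key := hB (p + i * M) (nx p + i * M) (fun s hs hsB => by
      refine hfree p hp (s - i * M) ⟨by linarith [hs.1], by linarith [hs.2]⟩ i hi ?_
      rw [← AddCircle.coe_nsmul, ← AddCircle.coe_add, nsmul_eq_mul, sub_add_cancel]
      exact hsB) (t + i * M) ⟨by linarith [ht.1], by linarith [ht.2]⟩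
    rw [← AddCircle.coe_nsmul, ← AddCircle.coe_add, ← AddCircle.coe_add, nsmul_eq_mul]
    exact key
  -- the first return times and the images of the left endpoints
  have hret : ∀ p : ℝ, ∃ n : ℕ, (1 ≤ n ∧ n ≤ N ∧ (p : AddCircle L) + n • (M : AddCircle L) ∈ Γ) ∧
      ∀ i : ℕ, 1 ≤ i → i < n → (p : AddCircle L) + i • (M : AddCircle L) ∉ Γ := by
    classical
    intro p
    have hex : ∃ n : ℕ, 1 ≤ n ∧ n ≤ N ∧ (p : AddCircle L) + n • (M : AddCircle L) ∈ Γ := by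
      obtain ⟨n, h1, h2, h3⟩ := hN p
      exact ⟨n, h1, h2, hVΓ h3⟩
    refine ⟨Nat.find hex, Nat.find_spec hex, fun i hi hi' hmem =>
      Nat.find_min hex hi' ⟨hi, ?_, hmem⟩⟩
    exact hi'.le.trans (Nat.find_spec hex).2.1
  choose n hn hn' using hret
  have hlift : ∀ p : ℝ, ∃ t ∈ Set.Ico x₀ (x₀ + L),
      (t : AddCircle L) = p + n p • (M : AddCircle L) :=
    fun p => exists_lift_mem_Ico hL x₀ _
  choose T hT hT' using hlift
  -- the labels enumerate the points of subdivision in `Γ`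
  have hPU : (P ∩ U).Finite := hPfin.inter_of_left U
  obtain ⟨d, ⟨e⟩⟩ := (Set.finite_coe_iff.2 hPU).exists_equiv_fin
  set a : Fin d → ℝ := fun i => (e.symm i : ℝ) with ha
  have haP : ∀ i, a i ∈ P := fun i => (e.symm i).2.1
  have haU : ∀ i, a i ∈ U := fun i => (e.symm i).2.2
  have hsurj : ∀ p ∈ P, p ∈ U → ∃ i, a i = p := fun p h1 h2 => ⟨e ⟨p, h1, h2⟩, by simp [ha]⟩
  have hainj : Function.Injective a := Subtype.val_injective.comp e.symm.injective
  set l : Fin d → ℝ := fun i => nx (a i) - a i with hl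
  have hal : ∀ i, a i + l i = nx (a i) := fun i => by simp [hl]
  have hlpos : ∀ i, 0 < l i := fun i => sub_pos.2 (hnx2 _ (haP i).1.2)
  have hTL : ∀ i, T (a i) + l i ≤ x₀ + L := by
    intro i
    by_contra! hlt
    refine hfree _ (haP i) (a i + (x₀ + L - T (a i))) ⟨by linarith [(hT (a i)).2], ?_⟩
      (n (a i)) (hn (a i)).2.1 ?_
    · rw [← hal]; linarith
    · have h1 : ((a i + (x₀ + L - T (a i)) : ℝ) : AddCircle L) + n (a i) • (M : AddCircle L) =
          x₀ := by
        rw [AddCircle.coe_add, AddCircle.coe_sub, hT', AddCircle.coe_add_period]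
        abel
      rw [h1]
      exact hx₀B
  have hcov : ∀ p ∈ P, p ∈ U → Set.Ico p (nx p) ⊆ U := by
    intro p hp hpU t ht
    refine ⟨⟨hp.1.1.trans ht.1, ht.2.trans_le (hnxle p hp)⟩, ?_⟩
    have := hconst p hp t ht 0 (Nat.zero_le _)
    simp only [zero_nsmul, add_zero] at this
    exact this.2 hpU.2
  have hpiece : ∀ t ∈ U, ∃ i, t ∈ Set.Ico (a i) (a i + l i) := by
    intro t ht
    obtain ⟨p, hp, hpt, hmax⟩ := hprev t ht.1
    have htp : t ∈ Set.Ico p (nx p) := by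
      refine ⟨hpt, ?_⟩
      by_contra! hle
      rcases hnx1 p hp.1.2 with h1 | h1
      · exact absurd (h1 ▸ hle) (not_le.2 ht.1.2)
      · exact absurd (hmax _ h1 hle) (not_le.2 (hnx2 p hp.1.2))
    have hpU : p ∈ U := by
      refine ⟨hp.1, ?_⟩
      have := hconst p hp t htp 0 (Nat.zero_le _)
      simp only [zero_nsmul, add_zero] at this
      exact this.1 ht.2
    obtain ⟨i, rfl⟩ := hsurj p hp hpU
    exact ⟨i, by rwa [hal]⟩
  have hI : ∀ i j t, t ∈ Set.Ico (a i) (a i + l i) → t ∈ Set.Ico (a j) (a j + l j) → i = j := by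
    have aux : ∀ i j t, t ∈ Set.Ico (a i) (a i + l i) → t ∈ Set.Ico (a j) (a j + l j) →
        ¬ a i < a j := by
      intro i j t hi hj hlt
      have := hnx3 (a i) (haP i).1.2 (a j) (Set.mem_insert_of_mem _ (haP j)) hlt
      rw [← hal] at this
      linarith [hi.2, hj.1]
    intro i j t hi hj
    exact hainj (le_antisymm (not_lt.1 (aux j i t hj hi)) (not_lt.1 (aux i j t hi hj)))
  have hIU : ⋃ i, Set.Ico (a i) (a i + l i) = U := by
    refine Set.Subset.antisymm (Set.iUnion_subset fun i => ?_) fun t ht =>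
      Set.mem_iUnion.2 (hpiece t ht)
    rw [hal]
    exact hcov _ (haP i) (haU i)
  -- each point of the piece with label `i` returns at time `n (a i)`
  have hreturn : ∀ i, ∀ t ∈ Set.Ico (a i) (a i + l i),
      (t : AddCircle L) + n (a i) • (M : AddCircle L) = ((t - a i + T (a i) : ℝ) : AddCircle L) ∧
      (t : AddCircle L) + n (a i) • (M : AddCircle L) ∈ Γ ∧
      ∀ k : ℕ, 1 ≤ k → k < n (a i) → (t : AddCircle L) + k • (M : AddCircle L) ∉ Γ := by
    intro i t ht
    rw [hal] at ht
    refine ⟨?_, ?_, fun k hk hk' => ?_⟩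
    · rw [AddCircle.coe_add, AddCircle.coe_sub, hT']
      abel
    · rw [hconst _ (haP i) t ht _ (hn _).2.1]
      exact (hn _).2.2
    · rw [hconst _ (haP i) t ht _ (hk'.le.trans (hn _).2.1)]
      exact hn' _ k hk hk'
  have hJsub : ∀ i, Set.Ico (T (a i)) (T (a i) + l i) ⊆ U := by
    intro i s hs
    refine ⟨⟨(hT (a i)).1.trans hs.1, hs.2.trans_le (hTL i)⟩, ?_⟩
    obtain ⟨h1, h2, -⟩ := hreturn i (s - T (a i) + a i) ⟨by linarith [hs.1], by linarith [hs.2]⟩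
    rw [h1] at h2
    simpa using h2
  have hJ : ∀ i j t, t ∈ Set.Ico (T (a i)) (T (a i) + l i) →
      t ∈ Set.Ico (T (a j)) (T (a j) + l j) → i = j := by
    intro i j s hi hj
    have mi : s - T (a i) + a i ∈ Set.Ico (a i) (a i + l i) :=
      ⟨by linarith [hi.1], by linarith [hi.2]⟩
    have mj : s - T (a j) + a j ∈ Set.Ico (a j) (a j + l j) :=
      ⟨by linarith [hj.1], by linarith [hj.2]⟩
    have ei : ((s - T (a i) + a i : ℝ) : AddCircle L) + n (a i) • (M : AddCircle L) = s := by
      rw [(hreturn i _ mi).1]; congr 1; ring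
    have ej : ((s - T (a j) + a j : ℝ) : AddCircle L) + n (a j) • (M : AddCircle L) = s := by
      rw [(hreturn j _ mj).1]; congr 1; ring
    have mU : ∀ {i t}, t ∈ Set.Ico (a i) (a i + l i) → t ∈ U := fun {i t} h =>
      hIU ▸ Set.mem_iUnion.2 ⟨i, h⟩
    -- a later return would contradict the earlier one
    have aux : ∀ i j p q, p ∈ Set.Ico (a i) (a i + l i) → q ∈ Set.Ico (a j) (a j + l j) →
        (p : AddCircle L) + n (a i) • (M : AddCircle L) =
          (q : AddCircle L) + n (a j) • (M : AddCircle L) → ¬ n (a i) < n (a j) := by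
      intro i j p q hp hq hpq hlt
      refine (hreturn j q hq).2.2 (n (a j) - n (a i)) (by omega)
        (by have := (hn (a i)).1; omega) ?_
      have : (q : AddCircle L) + (n (a j) - n (a i)) • (M : AddCircle L) = p := by
        have e1 : (q : AddCircle L) + (n (a j) - n (a i)) • (M : AddCircle L) +
            n (a i) • (M : AddCircle L) = p + n (a i) • (M : AddCircle L) := by
          rw [add_assoc, ← add_nsmul, Nat.sub_add_cancel hlt.le, hpq]
        exact add_right_cancel e1
      rw [this]
      exact (mU hp).2
    have hnn : n (a i) = n (a j) := le_antisymm
      (not_lt.1 (aux j i _ _ mj mi (ej.trans ei.symm)))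
      (not_lt.1 (aux i j _ _ mi mj (ei.trans ej.symm)))
    have e2 := ei.trans ej.symm
    rw [hnn] at e2
    have e3 := (AddCircle.coe_eq_coe_iff_of_mem_Ico (mU mi).1 (mU mj).1).1 (add_right_cancel e2)
    rw [← e3] at mj
    exact hI i j _ mi mj
  have hJU : U = ⋃ i, Set.Ico (T (a i)) (T (a i) + l i) := by
    refine Set.Subset.antisymm (fun s hs => ?_) (Set.iUnion_subset hJsub)
    classical
    -- follow the trajectory backwards to the preceding visit of `Γ`
    have hex : ∃ k : ℕ, 1 ≤ k ∧ (s : AddCircle L) - k • (M : AddCircle L) ∈ Γ := by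
      obtain ⟨k, h1, h2⟩ := hM.neg.exists_nsmul_mem hL (s : AddCircle L) hVopen hVne
      refine ⟨k, h1, hVΓ ?_⟩
      simpa [sub_eq_add_neg] using h2
    set k := Nat.find hex with hk
    obtain ⟨hk1, hkΓ⟩ := Nat.find_spec hex
    rw [← hk] at hk1 hkΓ
    obtain ⟨t, ht, hts⟩ := exists_lift_mem_Ico hL x₀ ((s : AddCircle L) - k • (M : AddCircle L))
    obtain ⟨i, hi⟩ := hpiece t ⟨ht, by rw [hts]; exact hkΓ⟩
    obtain ⟨h1, h2, h3⟩ := hreturn i t hi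
    have hsum : (t : AddCircle L) + k • (M : AddCircle L) = s := by rw [hts]; abel
    have hkn : k = n (a i) := by
      refine le_antisymm ?_ ?_
      · by_contra! hlt
        refine Nat.find_min hex (m := k - n (a i)) (by have := (hn (a i)).1; omega)
          ⟨by omega, ?_⟩
        have : (s : AddCircle L) - (k - n (a i)) • (M : AddCircle L) =
            t + n (a i) • (M : AddCircle L) := by
          rw [sub_eq_iff_eq_add, add_assoc, ← add_nsmul, Nat.add_sub_cancel' hlt.le, hsum]
        rw [this]
        exact h2
      · by_contra! hlt
        refine h3 k hk1 hlt ?_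
        rw [hsum]
        exact hs.2
    rw [← hkn, hsum] at h1
    have hmem : t - a i + T (a i) ∈ Set.Ico (T (a i)) (T (a i) + l i) :=
      ⟨by linarith [hi.1], by linarith [hi.2]⟩
    have := (AddCircle.coe_eq_coe_iff_of_mem_Ico hs.1 (hJsub i hmem).1).1 h1
    rw [this]
    exact Set.mem_iUnion.2 ⟨i, hmem⟩
  have hb : ∀ i, a i + l i ∈ ⋃ i, Set.Ico (a i) (a i + l i) → ∃ k, a k = a i + l i := by
    intro i hi
    rw [hIU, hal] at hi
    rw [hal]
    refine hsurj _ ?_ hi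
    rcases hnx1 (a i) (haP i).1.2 with h1 | h1
    · exact absurd hi.1.2 (by rw [h1]; exact lt_irrefl _)
    · exact h1
  have he : ∀ i, (∀ j, T (a j) + l j ≠ T (a i)) → ∃ k, a k = T (a i) := by
    intro i hi
    have hTU : T (a i) ∈ U := hJsub i ⟨le_rfl, by linarith [hlpos i]⟩
    refine hsurj _ ?_ hTU
    by_contra hnot
    obtain ⟨j, hj⟩ := hpiece _ hTU
    have hlt : a j < T (a i) := lt_of_le_of_ne hj.1 fun h => hnot (h ▸ haP j)
    obtain ⟨m, hm⟩ := exists_mem_Ioc_of_Ico_subset hlt (f := fun i => T (a i))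
      (g := fun i => T (a i) + l i) (by
        rw [← hJU, ← hIU]
        refine subset_trans ?_ (Set.subset_iUnion (fun i => Set.Ico (a i) (a i + l i)) j)
        exact Set.Ico_subset_Ico_right hj.2.le)
    rcases hm.2.lt_or_eq with h1 | h1
    · have := hJ m i _ ⟨hm.1.le, h1⟩ ⟨le_rfl, by linarith [hlpos i]⟩
      subst this
      exact lt_irrefl _ hm.1
    · exact hi m h1.symm
  obtain ⟨E, hE, hsep, hbegin, hxb, hxe⟩ := exists_intervalExchange (a := a) (l := l)
    (τ := fun i => T (a i)) hlpos hI hJ (hIU.trans hJU) hb he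
  refine ⟨d, E, hE, hsep, ?_, ?_⟩
  · simp only [hbegin]
    exact hIU
  · rintro t s ⟨i, ht, rfl⟩
    rw [hbegin] at ht
    obtain ⟨h1, h2, h3⟩ := hreturn i t ht
    refine ⟨n (a i), (hn _).1, ?_, ?_, ?_⟩
    · rw [iterate_circleRotation, h1, hxb, hxe]
    · rw [hxb, hxe, ← h1]
      exact h2
    · simpa only [iterate_circleRotation] using h3

end Existence

/-! ### Integral vectors -/

/-- A finite family of real numbers can be replaced by integers in such a way that its additive
relations and its strict order are preserved. -/
theorem exists_int_family {ι : Type*} [Finite ι] (f : ι → ℝ) :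
    ∃ F : ι → ℤ, (∀ i j k m, f i + f j = f k + f m → F i + F j = F k + F m) ∧
      ∀ i j, f i < f j → F i < F j := by
  set G := Submodule.span ℤ (Set.range f)
  have hfin : Module.Finite ℤ G := Module.Finite.span_of_finite ℤ (Set.finite_range f)
  have hfree : Module.Free ℤ G := inferInstance
  set c := Module.Free.chooseBasis ℤ G
  let φ : ℕ → G →ₗ[ℤ] ℤ := fun m => c.constr ℤ fun i => ⌊(m : ℝ) * (c i : ℝ)⌋
  have hlim : ∀ g : G, Filter.Tendsto (fun m : ℕ => ((φ m g : ℤ) : ℝ) / m) Filter.atTop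
      (nhds (g : ℝ)) := by
    intro g
    have h1 : (g : ℝ) = ∑ i, (c.repr g i : ℝ) * (c i : ℝ) := by
      have h0 := congrArg G.subtype (c.sum_repr g)
      rw [map_sum] at h0
      simpa [zsmul_eq_mul] using h0.symm
    rw [h1]
    have h2 : ∀ m : ℕ, ((φ m g : ℤ) : ℝ) / m =
        ∑ i, (c.repr g i : ℝ) * ((⌊(m : ℝ) * (c i : ℝ)⌋ : ℝ) / m) := by
      intro m
      simp only [φ, Module.Basis.constr_apply_fintype, Module.Basis.equivFun_apply, smul_eq_mul]
      push_cast
      rw [Finset.sum_div]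
      exact Finset.sum_congr rfl fun i _ => by ring
    simp only [h2]
    refine tendsto_finsetSum _ fun i _ => Filter.Tendsto.const_mul _ ?_
    have h4 : Filter.Tendsto (fun m : ℕ => (c i : ℝ) - 1 / (m : ℝ)) Filter.atTop
        (nhds ((c i : ℝ) - 0)) := tendsto_const_nhds.sub tendsto_one_div_atTop_nhds_zero_nat
    rw [sub_zero] at h4
    refine tendsto_of_tendsto_of_tendsto_of_le_of_le' h4 tendsto_const_nhds ?_ ?_
    · filter_upwards [Filter.eventually_gt_atTop 0] with m hm
      have hm' : (0 : ℝ) < m := by exact_mod_cast hm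
      rw [le_div_iff₀ hm', sub_mul, one_div, inv_mul_cancel₀ hm'.ne']
      linarith [Int.sub_one_lt_floor ((m : ℝ) * (c i : ℝ))]
    · filter_upwards [Filter.eventually_gt_atTop 0] with m hm
      have hm' : (0 : ℝ) < m := by exact_mod_cast hm
      rw [div_le_iff₀ hm', mul_comm]
      exact Int.floor_le _
  let f' : ι → G := fun i => ⟨f i, Submodule.subset_span ⟨i, rfl⟩⟩
  have hev : ∀ᶠ m : ℕ in Filter.atTop, ∀ p : ι × ι, f p.1 < f p.2 →
      φ m (f' p.1) < φ m (f' p.2) := by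
    rw [Filter.eventually_all]
    rintro ⟨i, j⟩
    by_cases hij : f i < f j
    · filter_upwards [(hlim (f' i)).eventually_lt (hlim (f' j)) hij,
        Filter.eventually_gt_atTop 0] with m hm hm0 _
      have hm' : (0 : ℝ) < m := by exact_mod_cast hm0
      rw [div_lt_div_iff_of_pos_right hm'] at hm
      exact_mod_cast hm
    · exact Filter.Eventually.of_forall fun m h => absurd h hij
  obtain ⟨m, hm⟩ := hev.exists
  refine ⟨fun i => φ m (f' i), fun i j k n h => ?_, fun i j h => hm (i, j) h⟩
  have : f' i + f' j = f' k + f' n := Subtype.ext h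
  simp only [← map_add, this]

/-- Adding a perturbation to a large multiple keeps strict inequalities, with any prescribed
gap. -/
theorem exists_multiple_gap {ι : Type*} [Finite ι] (x z : ι → ℤ) (D : ℤ) :
    ∃ m : ℤ, ∀ i j, x i < x j → m * x i + z i + D ≤ m * x j + z j := by
  have := Fintype.ofFinite ι
  set m : ℤ := ∑ i, |z i| + ∑ i, |z i| + |D| with hm
  have hb : ∀ i, |z i| ≤ ∑ i, |z i| := fun i =>
    Finset.single_le_sum (f := fun i => |z i|) (fun i _ => abs_nonneg _) (Finset.mem_univ i)
  refine ⟨m, fun i j hij => ?_⟩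
  have h0 : 0 ≤ m := by positivity
  have h1 : m * (x i + 1) ≤ m * x j := mul_le_mul_of_nonneg_left hij h0
  have h2 := hb i
  have h3 := hb j
  have h4 := le_abs_self (z i)
  have h5 := neg_abs_le (z j)
  have h6 := le_abs_self D
  linarith

namespace Scheme

variable {A : Type u}

theorem sum_scheme [Fintype A] (σ : Scheme A) (F : A × Side → ℤ) :
    ∑ α, (F (σ (α, Side.b)) + F (σ (α, Side.e))) = ∑ α, (F (α, Side.b) + F (α, Side.e)) := by
  have h : ∀ G : A × Side → ℤ, ∑ ξ, G ξ = ∑ α, (G (α, Side.b) + G (α, Side.e)) := by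
    intro G
    rw [Fintype.sum_prod_type]
    refine Finset.sum_congr rfl fun α _ => ?_
    change (Finset.sum ⟨↑[Side.b, Side.e], _⟩ fun s => G (α, s)) = _
    simp [Finset.sum]
  rw [← h, ← h (fun ξ => F (σ ξ)), Equiv.sum_comp]

/-- An integral vector allowed by a scheme. -/
def AllowsInt (σ : Scheme A) (x : A × Side → ℤ) : Prop :=
  ∀ α, x (σ (α, Side.b)) + x (σ (α, Side.e)) = x (α, Side.b) + x (α, Side.e)

/-- Lengths are orthogonal to displacements. -/
theorem AllowsInt.sum_mul_eq_zero [Fintype A] {σ : Scheme A} {x : A × Side → ℤ}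
    (hx : σ.AllowsInt x) :
    ∑ α, (x (σ (α, Side.e)) - x (α, Side.b)) * (x (σ (α, Side.b)) - x (α, Side.b)) = 0 := by
  have h := σ.sum_scheme fun ξ => x ξ ^ 2
  have h2 : ∑ α, ((x (σ (α, Side.b)) ^ 2 + x (σ (α, Side.e)) ^ 2) -
      (x (α, Side.b) ^ 2 + x (α, Side.e) ^ 2)) =
      ∑ α, -2 * ((x (σ (α, Side.e)) - x (α, Side.b)) * (x (σ (α, Side.b)) - x (α, Side.b))) := by
    refine Finset.sum_congr rfl fun α _ => ?_
    have : x (α, Side.e) = x (σ (α, Side.b)) + x (σ (α, Side.e)) - x (α, Side.b) := by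
      linarith [hx α]
    rw [this]; ring
  rw [Finset.sum_sub_distrib, sub_eq_zero.2 h, ← Finset.mul_sum] at h2
  linarith

/-- The displacements of a vector that is constant along the cycles of the dual scheme are
orthogonal to the lengths for the dual scheme. -/
theorem AllowsInt.sum_mul_coboundary [Fintype A] {σ : Scheme A} {x h : A × Side → ℤ}
    (hx : σ.AllowsInt x) (hh : ∀ ξ, h (σ.dual ξ) = h ξ) :
    ∑ α, (x (σ (α, Side.e)) - x (α, Side.b)) * (h (σ (α, Side.b)) - h (α, Side.b)) = 0 := by
  have hs := σ.sum_scheme fun ξ => h ξ * x ξ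
  have h1 : ∀ α, h (σ (α, Side.b)) = h (α, Side.e) := fun α => hh (α, Side.e)
  have h2 : ∀ α, h (σ (α, Side.e)) = h (α, Side.b) := fun α => hh (α, Side.b)
  have h3 : ∑ α, ((h (σ (α, Side.b)) * x (σ (α, Side.b)) + h (σ (α, Side.e)) * x (σ (α, Side.e))) -
      (h (α, Side.b) * x (α, Side.b) + h (α, Side.e) * x (α, Side.e))) =
      ∑ α, -((x (σ (α, Side.e)) - x (α, Side.b)) * (h (σ (α, Side.b)) - h (α, Side.b))) := by
    refine Finset.sum_congr rfl fun α _ => ?_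
    have : x (α, Side.e) = x (σ (α, Side.b)) + x (σ (α, Side.e)) - x (α, Side.b) := by
      linarith [hx α]
    rw [this, h1, h2]; ring
  rw [Finset.sum_sub_distrib, sub_eq_zero.2 hs, Finset.sum_neg_distrib] at h3
  linarith

/-- An integral vector `x` allowed by `σ` is a *tower model* if its lengths for the dual scheme
are positive, so that they may serve as heights of towers over the labels, if the coordinates
within each dual cycle are different, so that the segments of `σ` will not touch, and if the
displacements of the dual exchange have no common divisor up to shifts of the dual cycles, so that
the towers will form a single circle. -/
structure IsTowerModel (σ : Scheme A) (x : A × Side → ℤ) : Prop where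
  allowed : σ.AllowsInt x
  pos : ∀ α, x (α, Side.b) < x (σ (α, Side.e))
  inj : ∀ ξ η, σ.dual.SameCycle ξ η → x ξ = x η → ξ = η
  primitive : ∀ (g : ℕ) (z : A × Side → ℤ), (∀ ξ, z (σ.dual ξ) - z ξ = x (σ.dual ξ) - x ξ) →
    (∀ α, (g : ℤ) ∣ z (σ (α, Side.b)) - z (α, Side.b)) → g = 1

theorem exists_int_of_allows [Finite A] {σ : Scheme A} {x : A × Side → ℝ} (hx : σ.Allows x) :
    ∃ X : A × Side → ℤ, σ.AllowsInt X ∧ ∀ ξ η, x ξ < x η → X ξ < X η := by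
  obtain ⟨X, h1, h2⟩ := exists_int_family x
  exact ⟨X, fun α => h1 _ _ _ _ (by linarith [hx α]), h2⟩

/-- For a rotational scheme, different elements of a dual cycle are separated by some vector
allowed by the scheme. -/
theorem exists_separating [Finite A] {σ : Scheme A} {x y : A × Side → ℤ} (hx : σ.AllowsInt x)
    (hy : σ.AllowsInt y) (hxr : σ.Rises x) (hyr : σ.dual.Rises y) (hσ : σ.UniquePeaks)
    (hσ' : σ.dual.UniquePeaks) {ξ η : A × Side} (hc : σ.dual.SameCycle ξ η) (hne : ξ ≠ η) :
    ∃ z, σ.AllowsInt z ∧ z ξ ≠ z η := by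
  classical
  -- the cycles of `σ` may be shifted independently of each other
  have hshift : ¬ σ.SameCycle ξ η → ∃ z, σ.AllowsInt z ∧ z ξ ≠ z η := by
    intro hnot
    refine ⟨fun ζ => if σ.SameCycle ξ ζ then 1 else 0, fun α => ?_, ?_⟩
    · simp only [Equiv.Perm.sameCycle_apply_right]
    · simp [Equiv.Perm.SameCycle.refl, hnot]
  have mixed : ∀ α β, σ.dual.SameCycle (α, Side.b) (β, Side.e) →
      y (α, Side.b) ≠ y (β, Side.e) ∨ (σ.SameCycle (α, Side.b) (β, Side.e) →
        x (α, Side.b) ≠ x (β, Side.e)) := by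
    intro α β hc
    obtain ⟨⟨γ, s⟩, hγ⟩ := σ.dual.surjective (α, Side.b)
    obtain ⟨⟨δ, t⟩, hδ⟩ := σ.dual.surjective (β, Side.e)
    rcases s with _ | _
    · rcases t with _ | _
      · exact Or.inl (hyr.lt_peak hσ' hδ hc.symm (by simp)).ne
      · refine Or.inr fun hcσ => (hxr.valley_lt hσ hγ hcσ (by simp)).ne
    · exact Or.inl (hyr.valley_lt hσ' hγ hc (by simp)).ne
  obtain ⟨α, _ | _⟩ := ξ <;> obtain ⟨β, _ | _⟩ := η
  · refine ⟨y, hy, fun heq => hne ?_⟩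
    rw [hyr.begin_unique hσ' hc ⟨le_rfl, hyr.up α⟩ ⟨heq.ge, heq ▸ hyr.up β⟩]
  · rcases mixed α β hc with h | h
    · exact ⟨y, hy, h⟩
    · by_cases hcσ : σ.SameCycle (α, Side.b) (β, Side.e)
      · exact ⟨x, hx, h hcσ⟩
      · exact hshift hcσ
  · rcases mixed β α hc.symm with h | h
    · exact ⟨y, hy, h.symm⟩
    · by_cases hcσ : σ.SameCycle (α, Side.e) (β, Side.b)
      · exact ⟨x, hx, (h hcσ.symm).symm⟩
      · exact hshift hcσ
  · refine ⟨y, hy, fun heq => hne ?_⟩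
    rw [hyr.end_unique hσ' hc (t := max (y (σ.dual (α, Side.e))) (y (σ.dual (β, Side.e))))
      ⟨le_max_left _ _, max_lt (hyr.down α) (heq ▸ hyr.down β)⟩
      ⟨le_max_right _ _, max_lt (heq ▸ hyr.down α) (hyr.down β)⟩]

theorem AllowsInt.mul_add {σ : Scheme A} {x z : A × Side → ℤ} (hx : σ.AllowsInt x)
    (hz : σ.AllowsInt z) (m : ℤ) : σ.AllowsInt fun ξ => m * x ξ + z ξ := by
  intro α
  linear_combination m * hx α + hz α

/-- Generic dual lengths separate the elements of each dual cycle. -/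
theorem exists_generic [Finite A] {σ : Scheme A} {x y : A × Side → ℤ} (hx : σ.AllowsInt x)
    (hy : σ.AllowsInt y) (hxr : σ.Rises x) (hyr : σ.dual.Rises y) (hσ : σ.UniquePeaks)
    (hσ' : σ.dual.UniquePeaks) :
    ∃ z, σ.AllowsInt z ∧ (∀ α, z (α, Side.b) < z (σ (α, Side.e))) ∧
      ∀ ξ η, σ.dual.SameCycle ξ η → z ξ = z η → ξ = η := by
  suffices h : ∀ S : Set ((A × Side) × (A × Side)), S.Finite → ∃ z, σ.AllowsInt z ∧
      (∀ α, z (α, Side.b) < z (σ (α, Side.e))) ∧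
      ∀ p ∈ S, σ.dual.SameCycle p.1 p.2 → z p.1 = z p.2 → p.1 = p.2 by
    obtain ⟨z, h1, h2, h3⟩ := h Set.univ (Set.toFinite _)
    exact ⟨z, h1, h2, fun ξ η => h3 (ξ, η) (Set.mem_univ _)⟩
  intro S hS
  induction S, hS using Set.Finite.induction_on with
  | empty => exact ⟨y, hy, hyr.up, by simp⟩
  | @insert p S _ _ ih =>
    obtain ⟨z, h1, h2, h3⟩ := ih
    by_cases hp : σ.dual.SameCycle p.1 p.2 ∧ p.1 ≠ p.2
    · obtain ⟨u, hu1, hu2⟩ := exists_separating hx hy hxr hyr hσ hσ' hp.1 hp.2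
      obtain ⟨m, hm⟩ := exists_multiple_gap z u 1
      refine ⟨_, h1.mul_add hu1 m, fun α => by linarith [hm _ _ (h2 α)], ?_⟩
      have hz : ∀ ξ η, m * z ξ + u ξ = m * z η + u η → z ξ = z η := by
        intro ξ η h
        rcases lt_trichotomy (z ξ) (z η) with h4 | h4 | h4
        · linarith [hm _ _ h4]
        · exact h4
        · linarith [hm _ _ h4]
      rintro q (rfl | hq) hqc hqe
      · have := hz _ _ hqe
        rw [this] at hqe
        exact absurd (add_left_cancel hqe) hu2
      · exact h3 q hq hqc (hz _ _ hqe)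
    · refine ⟨z, h1, h2, ?_⟩
      rintro q (rfl | hq) hqc hqe
      · by_contra hne
        exact hp ⟨hqc, hne⟩
      · exact h3 q hq hqc hqe

/-- Every rotational scheme over a non-empty alphabet has a tower model. A large multiple of a
generic vector with positive dual lengths is perturbed by a vector with positive lengths; the
pairing of the latter with the former bounds the common divisors of the displacements, and the
largest one is divided out. -/
theorem IsRotational.exists_isTowerModel [Finite A] [Nonempty A] {σ : Scheme A}
    (h : σ.IsRotational) : ∃ x, σ.IsTowerModel x := by
  have := Fintype.ofFinite A
  have hσ := h.1.uniquePeaks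
  have hσ' := h.2.uniquePeaks
  obtain ⟨xv, hxv, hxvp⟩ := h.1.1
  obtain ⟨xw, hxw, hxwp⟩ := h.2.1
  have hrv := Rises.of_allows hxv hxvp
  have hrw := Rises.of_allows hxw hxwp
  obtain ⟨v, hv, hvlt⟩ := exists_int_of_allows hxv
  obtain ⟨w, hw, hwlt⟩ := exists_int_of_allows ((allows_dual_iff σ xw).1 hxw)
  have hvr : σ.Rises v := ⟨fun α => hvlt _ _ (hrv.up α), fun α => hvlt _ _ (hrv.down α)⟩
  have hwr : σ.dual.Rises w := ⟨fun α => hwlt _ _ (hrw.up α), fun α => hwlt _ _ (hrw.down α)⟩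
  obtain ⟨y, hy, hypos, hyinj⟩ := exists_generic hv hw hvr hwr hσ hσ'
  set D : ℤ := ∑ α, (y (σ (α, Side.e)) - y (α, Side.b)) * (v (σ (α, Side.b)) - v (α, Side.b))
    with hD
  have hDpos : 0 < D := Finset.sum_pos (fun α _ => mul_pos (sub_pos.2 (hypos α))
    (sub_pos.2 (hvr.up α))) Finset.univ_nonempty
  obtain ⟨m, hm⟩ := exists_multiple_gap y v D
  set X : A × Side → ℤ := fun ξ => m * y ξ + v ξ with hX
  have hXa : σ.AllowsInt X := hy.mul_add hv m
  -- the admissible divisors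
  let Q : ℕ → Prop := fun g => ∃ z : A × Side → ℤ,
    (∀ ξ, z (σ.dual ξ) - z ξ = X (σ.dual ξ) - X ξ) ∧
      ∀ α, (g : ℤ) ∣ z (σ (α, Side.b)) - z (α, Side.b)
  have hQdvd : ∀ g, Q g → (g : ℤ) ∣ D := by
    rintro g ⟨z, hz, hg⟩
    have h1 : ∑ α, (y (σ (α, Side.e)) - y (α, Side.b)) * (z (σ (α, Side.b)) - z (α, Side.b)) =
        D := by
      have h2 := hy.sum_mul_coboundary (h := fun ξ => z ξ - X ξ) (fun ξ => by linarith [hz ξ])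
      have h3 := hy.sum_mul_eq_zero
      have h4 : ∑ α, (y (σ (α, Side.e)) - y (α, Side.b)) * (z (σ (α, Side.b)) - z (α, Side.b)) =
          ∑ α, (y (σ (α, Side.e)) - y (α, Side.b)) *
            ((z (σ (α, Side.b)) - X (σ (α, Side.b))) - (z (α, Side.b) - X (α, Side.b))) +
          (m * ∑ α, (y (σ (α, Side.e)) - y (α, Side.b)) * (y (σ (α, Side.b)) - y (α, Side.b)) +
            D) := by
        rw [hD, Finset.mul_sum, ← Finset.sum_add_distrib, ← Finset.sum_add_distrib]
        refine Finset.sum_congr rfl fun α _ => ?_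
        simp only [hX]
        ring
      rw [h4, h2, h3]
      ring
    rw [← h1]
    exact Finset.dvd_sum fun α _ => Dvd.dvd.mul_left (hg α) _
  have hQle : ∀ g, Q g → 0 < g ∧ (g : ℤ) ≤ D := fun g hg => by
    have h1 := hQdvd g hg
    refine ⟨Nat.pos_of_ne_zero fun h0 => ?_, Int.le_of_dvd hDpos h1⟩
    subst h0
    rw [Nat.cast_zero, zero_dvd_iff] at h1
    exact hDpos.ne' h1
  obtain ⟨g, ⟨z, hz, hg⟩, hmax⟩ := Set.exists_max_image {g | Q g} id
    ((Set.finite_Iic D.toNat).subset fun g hg => by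
      have := (hQle g hg).2
      simp only [Set.mem_Iic]
      omega) ⟨1, X, fun _ => rfl, fun α => by simp⟩
  obtain ⟨hg0, hgD⟩ := hQle g ⟨z, hz, hg⟩
  have hgpos : (0 : ℤ) < g := by exact_mod_cast hg0
  choose k hk using hg
  have hz1 : ∀ α, z (σ (α, Side.b)) = z (α, Side.b) + k α * g := fun α => by linarith [hk α]
  have hz2 : ∀ α, z (α, Side.e) = z (σ (α, Side.e)) + k α * g := fun α => by
    have h1 := hz (α, Side.b)
    have h2 := hz (α, Side.e)
    rw [dual_b] at h1
    rw [dual_e] at h2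
    linarith [hXa α, hk α]
  have hd1 : ∀ α, z (σ (α, Side.b)) / g = z (α, Side.b) / g + k α := fun α => by
    rw [hz1, Int.add_mul_ediv_right _ _ hgpos.ne']
  have hd2 : ∀ α, z (α, Side.e) / g = z (σ (α, Side.e)) / g + k α := fun α => by
    rw [hz2, Int.add_mul_ediv_right _ _ hgpos.ne']
  have hgap : ∀ a b : ℤ, a + D ≤ b → a / g < b / g := by
    intro a b hab
    have h1 : a + 1 * (g : ℤ) ≤ b := by linarith
    have h2 := Int.ediv_le_ediv hgpos h1
    rw [Int.add_mul_ediv_right _ _ hgpos.ne'] at h2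
    linarith
  -- all lengths of `z` are multiples of `g`, so rounding keeps the vector allowed
  refine ⟨fun ξ => z ξ / g, fun α => ?_, fun α => hgap _ _ ?_, fun ξ η hc heq => ?_,
    fun g' z' hz' hg' => ?_⟩
  · rw [hd1, hd2]
    ring
  · have h1 := hz (α, Side.b)
    rw [dual_b] at h1
    have h2 := hm _ _ (hypos α)
    simp only [hX] at h1
    linarith
  · have hinv : z ξ - X ξ = z η - X η :=
      Equiv.Perm.SameCycle.eq_of_invariant (h := fun ξ => z ξ - X ξ)
        (fun ζ => by linarith [hz ζ]) hc
    simp only [hX] at hinv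
    refine hyinj ξ η hc ?_
    rcases lt_trichotomy (y ξ) (y η) with h4 | h4 | h4
    · exact absurd heq (hgap _ _ (by linarith [hm _ _ h4])).ne
    · exact h4
    · exact absurd heq (hgap _ _ (by linarith [hm _ _ h4])).ne'
  · have hQ : Q (g * g') := by
      refine ⟨fun ξ => z ξ + g * (z' ξ - z ξ / g), fun ξ => ?_, fun α => ?_⟩
      · have := hz' ξ
        linear_combination hz ξ + (g : ℤ) * this
      · obtain ⟨j, hj⟩ := hg' α
        refine ⟨j, ?_⟩
        simp only [hd1]
        push_cast
        rw [hz1]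
        linear_combination (g : ℤ) * hj
    have h1 : g * g' ≤ g := hmax _ hQ
    have h2 := (hQle _ hQ).1
    have h3 : 0 < g' := Nat.pos_of_mul_pos_left h2
    have h4 : g' ≤ 1 := by
      by_contra! hlt
      nlinarith
    omega

end Scheme

/-! ### Towers -/

namespace Scheme

variable {A : Type u}

/-- Each cycle contains a beginning element, which may be chosen uniformly for the cycle. -/
theorem Rises.exists_representative [Finite A] {σ : Scheme A} {K : Type*} [LinearOrder K]
    {x : A × Side → K} (h : σ.Rises x) :
    ∃ r : A × Side → A, (∀ ξ, r (σ ξ) = r ξ) ∧ ∀ ξ, σ.SameCycle ξ (r ξ, Side.b) := by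
  have hex : ∀ ξ, ∃ α, σ.SameCycle ξ (α, Side.b) := fun ξ => by
    obtain ⟨α, -, -, hα⟩ := h.exists_peak ξ
    exact ⟨α, hα⟩
  choose c hc using hex
  let q : A × Side → Quotient (Equiv.Perm.SameCycle.setoid σ) := Quotient.mk _
  refine ⟨fun ξ => c (q ξ).out, fun ξ => ?_, fun ξ => ?_⟩
  · have : q (σ ξ) = q ξ := Quotient.sound (Equiv.Perm.sameCycle_apply_left.2
      (Equiv.Perm.SameCycle.refl _ _))
    change c (q (σ ξ)).out = c (q ξ).out
    rw [this]
  · have h1 : σ.SameCycle (q ξ).out ξ := Quotient.mk_out (s := Equiv.Perm.SameCycle.setoid σ) ξ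
    exact h1.symm.trans (hc _)

/-- The floors of the towers with integral coordinates: the tower over the label `α` has the floors
`x (αb), …, x (σ(αe)) - 1`. -/
abbrev Floor (σ : Scheme A) (x : A × Side → ℤ) : Type u :=
  {y : A × ℤ // x (y.1, Side.b) ≤ y.2 ∧ y.2 < x (σ (y.1, Side.e))}

instance [Finite A] (σ : Scheme A) (x : A × Side → ℤ) : Finite (Floor σ x) := by
  refine Finite.of_injective (β := Σ α, Set.Ico (x (α, Side.b)) (x (σ (α, Side.e))))
    (fun y => ⟨y.1.1, y.1.2, y.2⟩) ?_
  rintro ⟨⟨α, t⟩, h⟩ ⟨⟨β, s⟩, h'⟩ heq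
  simp only [Sigma.mk.injEq] at heq
  obtain ⟨rfl, h2⟩ := heq
  have := congrArg Subtype.val (eq_of_heq h2)
  simp only at this
  subst this
  rfl

/-- The permutation `τ` carries each floor to its right neighbour: the right side of a floor over
`α` is at the height shifted by the length of `α`, and there it is glued to a left side within the
same dual cycle. -/
def IsRightNeighbour (σ : Scheme A) (x : A × Side → ℤ) (τ : Equiv.Perm (Floor σ x)) : Prop :=
  ∀ y : Floor σ x, σ.dual.SameCycle (y.1.1, Side.e) ((τ y).1.1, Side.b) ∧
    (τ y).1.2 = y.1.2 + (x (σ (y.1.1, Side.b)) - x (y.1.1, Side.b))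

/-- The place above a floor: the next floor of the same tower or, from the top floor, the left end
of the ending interval. Places are given by the positions `p` of floors and `X` of endpoints. -/
noncomputable def above {σ : Scheme A} {x : A × Side → ℤ} {Z : Type*} (p : Floor σ x → Z)
    (X : A × Side → Z) (y : Floor σ x) : Z :=
  if h : y.1.2 + 1 < x (σ (y.1.1, Side.e)) then
    p ⟨(y.1.1, y.1.2 + 1), by have := y.2.1; dsimp only; omega, h⟩
  else X (σ (y.1.1, Side.e))

namespace IsTowerModel

variable {σ : Scheme A} {x : A × Side → ℤ}

theorem dual_rises (h : σ.IsTowerModel x) : σ.dual.Rises x :=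
  ⟨h.pos, fun α => by rw [dual_e]; linarith [h.allowed α, h.pos α]⟩

/-- The bottom floor of a tower. -/
def bottom (h : σ.IsTowerModel x) (α : A) : Floor σ x := ⟨(α, x (α, Side.b)), le_rfl, h.pos α⟩

/-- The position of the right side of a floor within its ending interval. -/
theorem shift_mem (h : σ.IsTowerModel x) (y : Floor σ x) :
    y.1.2 + (x (σ (y.1.1, Side.b)) - x (y.1.1, Side.b)) ∈
      Set.Ico (x (σ.dual (y.1.1, Side.e))) (x (y.1.1, Side.e)) := by
  have := h.allowed y.1.1
  rw [dual_e]
  exact ⟨by linarith [y.2.1], by linarith [y.2.2]⟩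

variable {τ : Equiv.Perm (Floor σ x)}

/-- Bottoms of towers are neighbours only within a beginning segment. This is what keeps the
segments apart. -/
theorem eq_of_right_bottom (h : σ.IsTowerModel x) (hτ : σ.IsRightNeighbour x τ) {α β : A}
    (hαβ : τ (h.bottom α) = h.bottom β) : σ (α, Side.b) = (β, Side.b) := by
  obtain ⟨h1, h2⟩ := hτ (h.bottom α)
  rw [hαβ] at h1 h2
  refine h.inj _ _ ?_ ?_
  · rw [← dual_e, Equiv.Perm.sameCycle_apply_left]
    exact h1
  · change x (β, Side.b) = x (α, Side.b) + (x (σ (α, Side.b)) - x (α, Side.b)) at h2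
    rw [h2]; ring

/-- Positions along a tower are iterates of the vertical move `ρ`. -/
theorem climb (h : σ.IsTowerModel x) {Z : Type*} {ρ : Z → Z} {p : Floor σ x → Z}
    {X : A × Side → Z} (hρ : ∀ y, above p X y = ρ (p y))
    (hX : ∀ α, X (α, Side.b) = p (h.bottom α)) :
    (∀ y : Floor σ x, p y = ρ^[(y.1.2 - x (y.1.1, Side.b)).toNat] (X (y.1.1, Side.b))) ∧
    ∀ α, X (σ (α, Side.e)) =
      ρ^[(x (σ (α, Side.e)) - x (α, Side.b)).toNat] (X (α, Side.b)) := by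
  have key : ∀ n : ℕ, ∀ y : Floor σ x, (y.1.2 - x (y.1.1, Side.b)).toNat = n →
      p y = ρ^[n] (X (y.1.1, Side.b)) := by
    intro n
    induction n with
    | zero =>
      intro y hy
      rw [hX, Function.iterate_zero, id]
      congr 1
      refine Subtype.ext (Prod.ext rfl ?_)
      have := y.2.1
      change y.1.2 = x (y.1.1, Side.b)
      omega
    | succ n ih =>
      intro y hy
      have h1 := y.2
      have h2 := ih ⟨(y.1.1, y.1.2 - 1), by dsimp only; omega, by dsimp only; omega⟩
        (by dsimp only; omega)
      rw [Function.iterate_succ_apply', ← h2, ← hρ, above, dif_pos (by dsimp only; omega)]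
      congr 1
      refine Subtype.ext (Prod.ext rfl ?_)
      dsimp only
      omega
  refine ⟨fun y => key _ y rfl, fun α => ?_⟩
  have hpos := h.pos α
  have h1 := hρ ⟨(α, x (σ (α, Side.e)) - 1), by dsimp only; omega, by dsimp only; omega⟩
  rw [above, dif_neg (by dsimp only; omega), key _ _ rfl, ← Function.iterate_succ_apply' ρ] at h1
  rw [h1]
  congr 2
  dsimp only
  omega

variable [Finite A]

theorem exists_right (h : σ.IsTowerModel x) (hσ' : σ.dual.UniquePeaks) :
    ∃ τ : Equiv.Perm (Floor σ x), σ.IsRightNeighbour x τ := by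
  have hex : ∀ y : Floor σ x, ∃ y' : Floor σ x,
      σ.dual.SameCycle (y.1.1, Side.e) (y'.1.1, Side.b) ∧
        y'.1.2 = y.1.2 + (x (σ (y.1.1, Side.b)) - x (y.1.1, Side.b)) := by
    intro y
    obtain ⟨β, h1, h2⟩ := h.dual_rises.exists_begin (h.shift_mem y)
    exact ⟨⟨(β, _), h2⟩, h1, rfl⟩
  choose f hf using hex
  have hinj : Function.Injective f := by
    intro y y' hyy
    have h1 := hf y
    have h2 := hf y'
    rw [← hyy] at h2
    have m1 := h.shift_mem y
    have m2 := h.shift_mem y'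
    rw [← h1.2] at m1
    rw [← h2.2] at m2
    have h3 := h.dual_rises.end_unique hσ' (h1.1.trans h2.1.symm) m1 m2
    refine Subtype.ext (Prod.ext h3 ?_)
    have h4 := h1.2.symm.trans h2.2
    rw [h3] at h4
    linarith
  exact ⟨Equiv.ofBijective f (Finite.injective_iff_bijective.1 hinj), hf⟩

theorem right_eq (h : σ.IsTowerModel x) (hσ' : σ.dual.UniquePeaks) (hτ : σ.IsRightNeighbour x τ)
    {y y' : Floor σ x} (hc : σ.dual.SameCycle (y.1.1, Side.e) (y'.1.1, Side.b))
    (ht : y'.1.2 = y.1.2 + (x (σ (y.1.1, Side.b)) - x (y.1.1, Side.b))) : τ y = y' := by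
  obtain ⟨h1, h2⟩ := hτ y
  have h3 : (τ y).1.2 = y'.1.2 := h2.trans ht.symm
  have m1 : (τ y).1.2 ∈ Set.Ico (x ((τ y).1.1, Side.b)) (x (σ.dual ((τ y).1.1, Side.b))) := (τ y).2
  have m2 : (τ y).1.2 ∈ Set.Ico (x (y'.1.1, Side.b)) (x (σ.dual (y'.1.1, Side.b))) := h3 ▸ y'.2
  exact Subtype.ext (Prod.ext (h.dual_rises.begin_unique hσ' (h1.symm.trans hc) m1 m2) h3)

/-- Consecutive beginning intervals are the bottoms of neighbouring towers. -/
theorem right_bottom (h : σ.IsTowerModel x) (hσ' : σ.dual.UniquePeaks)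
    (hτ : σ.IsRightNeighbour x τ) {α β : A} (hαβ : σ (α, Side.b) = (β, Side.b)) :
    τ (h.bottom α) = h.bottom β := by
  refine h.right_eq hσ' hτ ?_ ?_
  · change σ.dual.SameCycle (α, Side.e) (β, Side.b)
    rw [← hαβ, ← dual_e]
    simp [Equiv.Perm.SameCycle.refl]
  · change x (β, Side.b) = x (α, Side.b) + (x (σ (α, Side.b)) - x (α, Side.b))
    rw [hαβ]; ring

/-- The places above neighbouring floors are neighbours. If the move to the right neighbour
changes positions by `a`, this remains true one level up, across the segments too. -/
theorem above_right (h : σ.IsTowerModel x) (hσ' : σ.dual.UniquePeaks)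
    (hτ : σ.IsRightNeighbour x τ) {Z : Type*} {a : A → Z → Z} {p : Floor σ x → Z}
    {X : A × Side → Z} (hp : ∀ y, p (τ y) = a y.1.1 (p y))
    (hX : ∀ α, X (α, Side.b) = p (h.bottom α))
    (hXb : ∀ α, X (σ (α, Side.b)) = a α (X (α, Side.b)))
    (hXe : ∀ α, X (α, Side.e) = a α (X (σ (α, Side.e)))) (y : Floor σ x) :
    above p X (τ y) = a y.1.1 (above p X y) := by
  obtain ⟨hc, hs⟩ := hτ y
  have hall := h.allowed y.1.1
  have hyσ := y.2
  have hy'σ := (τ y).2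
  by_cases h1 : y.1.2 + 1 < x (σ (y.1.1, Side.e))
  · by_cases h2 : (τ y).1.2 + 1 < x (σ ((τ y).1.1, Side.e))
    · rw [above, above, dif_pos h1, dif_pos h2]
      refine Eq.trans ?_ (hp ⟨(y.1.1, y.1.2 + 1), by dsimp only; omega, h1⟩)
      congr 1
      refine (h.right_eq hσ' hτ ?_ ?_).symm
      · exact hc
      · simp only [hs]
        ring
    · -- the left side ends at a division point, which is inside the right side
      rw [above, above, dif_pos h1, dif_neg h2]
      have e1 : (τ y).1.2 + 1 = x (σ ((τ y).1.1, Side.e)) := by omega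
      rcases hη : σ ((τ y).1.1, Side.e) with ⟨γ, _ | _⟩
      · rw [hX]
        refine Eq.trans ?_ (hp ⟨(y.1.1, y.1.2 + 1), by dsimp only; omega, h1⟩)
        congr 1
        refine (h.right_eq hσ' hτ ?_ ?_).symm
        · refine hc.trans ?_
          change σ.dual.SameCycle _ (γ, Side.b)
          rw [← hη, ← dual_b]
          simp [Equiv.Perm.SameCycle.refl]
        · change x (γ, Side.b) = y.1.2 + 1 + (x (σ (y.1.1, Side.b)) - x (y.1.1, Side.b))
          rw [hη] at e1
          omega
      · exfalso
        have hd : σ.dual ((τ y).1.1, Side.b) = (γ, Side.e) := hη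
        have hdown := h.dual_rises.down γ
        rw [hη] at e1
        have hc' : σ.dual.SameCycle (y.1.1, Side.e) (γ, Side.e) := by
          rw [← hd, Equiv.Perm.sameCycle_apply_right]; exact hc
        have := h.dual_rises.end_unique hσ' hc' (t := (τ y).1.2)
          (by rw [hs]; exact h.shift_mem y) ⟨by omega, by omega⟩
        rw [← this] at e1
        omega
  · have e1 : y.1.2 + 1 = x (σ (y.1.1, Side.e)) := by omega
    by_cases h2 : (τ y).1.2 + 1 < x (σ ((τ y).1.1, Side.e))
    · -- the right side ends at a division point, which is inside the left side
      rw [above, above, dif_neg h1, dif_pos h2, ← hXe]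
      obtain ⟨⟨γ, s⟩, hγ⟩ := σ.dual.surjective (y.1.1, Side.e)
      have hcγ : σ.dual.SameCycle (γ, s) ((τ y).1.1, Side.b) := by
        rw [← Equiv.Perm.sameCycle_apply_left, hγ]; exact hc
      rcases s with _ | _
      · exfalso
        have hup := h.dual_rises.up γ
        rw [hγ] at hup
        have := h.dual_rises.begin_unique hσ' hcγ (t := (τ y).1.2)
          ⟨by omega, by rw [hγ]; omega⟩ (τ y).2
        rw [← this, ← dual_b, hγ] at h2
        omega
      · have hγ' : σ (γ, Side.b) = (y.1.1, Side.e) := hγ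
        rw [← hγ', hXb, hX]
        refine Eq.trans ?_ (hp (h.bottom γ))
        congr 1
        refine (h.right_eq hσ' hτ hcγ ?_).symm
        change (τ y).1.2 + 1 = x (γ, Side.b) + (x (σ (γ, Side.b)) - x (γ, Side.b))
        rw [hγ']
        omega
    · -- both sides end at the same point, and generic coordinates determine it
      rw [above, above, dif_neg h1, dif_neg h2, ← hXe]
      congr 1
      refine h.inj _ _ ?_ ?_
      · rw [← dual_b, Equiv.Perm.sameCycle_apply_left]
        exact hc.symm
      · omega

/-- The floors of all towers form a single cycle. The vertical move permutes the cycles of `τ`,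
transitively because the scheme is irreducible; the number of moves modulo the number of cycles
gives a coordinate, compared to which all displacements become divisible by the number of cycles,
and this is excluded unless there is one cycle only. -/
theorem sameCycle_right (h : σ.IsTowerModel x) (hσ : σ.UniquePeaks) (hσ' : σ.dual.UniquePeaks)
    (hirr : σ.Irreducible) {v : A × Side → ℝ} (hv : σ.Rises v) (hτ : σ.IsRightNeighbour x τ)
    (y y' : Floor σ x) : τ.SameCycle y y' := by
  classical
  set K := Quotient (Equiv.Perm.SameCycle.setoid τ)
  let q : Floor σ x → K := Quotient.mk _
  have hKfin : Finite K := Quotient.finite _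
  have hq : ∀ y, q (τ y) = q y := fun y =>
    Quotient.sound (Equiv.Perm.sameCycle_apply_left.2 (Equiv.Perm.SameCycle.refl _ _))
  obtain ⟨r, hr, hrc⟩ := hv.exists_representative
  let X : A × Side → K := fun ξ => q (h.bottom (r ξ))
  have hXσ : ∀ ξ, X (σ ξ) = X ξ := fun ξ => by simp only [X, hr]
  have hX : ∀ α, X (α, Side.b) = q (h.bottom α) := fun α =>
    (hv.eq_of_sameCycle hσ (f := fun α => q (h.bottom α)) (fun α β hαβ => by
      rw [← h.right_bottom hσ' hτ hαβ, hq]) (hrc (α, Side.b))).symm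
  have hab : ∀ y, above q X (τ y) = above q X y := fun y =>
    h.above_right hσ' hτ (a := fun _ k => k) hq hX (fun α => hXσ _) (fun α => (hXσ _).symm) y
  let ρ : K → K := Quotient.lift (above q X) fun a b hab' =>
    Equiv.Perm.SameCycle.eq_of_invariant hab hab'
  obtain ⟨hc1, hc2⟩ := h.climb (ρ := ρ) (p := q) (X := X) (fun y => rfl) hX
  have hsurjX : ∀ α, ∃ k, ρ k = X (α, Side.b) := by
    intro α
    obtain ⟨β, γ, h1, h2⟩ := hv.exists_valley (α, Side.b)
    have h3 : X (α, Side.b) = X (σ (β, Side.e)) := by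
      rw [hXσ]
      exact Equiv.Perm.SameCycle.eq_of_invariant hXσ h2
    rw [h3, hc2]
    have hpos : (x (σ (β, Side.e)) - x (β, Side.b)).toNat =
        (x (σ (β, Side.e)) - x (β, Side.b)).toNat - 1 + 1 := by
      have := h.pos β
      omega
    rw [hpos, Function.iterate_succ_apply']
    exact ⟨_, rfl⟩
  have hsurj : Function.Surjective ρ := by
    intro k
    obtain ⟨y, rfl⟩ := Quotient.exists_rep k
    change ∃ k', ρ k' = q y
    rw [hc1 y]
    rcases (y.1.2 - x (y.1.1, Side.b)).toNat with _ | n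
    · exact hsurjX _
    · rw [Function.iterate_succ_apply']
      exact ⟨_, rfl⟩
  let R : Equiv.Perm K := Equiv.ofBijective ρ (Finite.surjective_iff_bijective.1 hsurj)
  have hRρ : ∀ n k, ρ^[n] k = (R ^ n) k := fun n k => by
    rw [← Equiv.Perm.iterate_eq_pow]; rfl
  simp only [hRρ] at hc1 hc2
  set k₀ := X (y.1.1, Side.b) with hk₀
  have hXe : ∀ α, X (α, Side.e) =
      (R ^ (x (σ (α, Side.e)) - x (α, Side.b)).toNat) (X (α, Side.b)) := fun α => by
    rw [← hXσ, hc2]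
  have htrans : ∀ ξ, R.SameCycle k₀ (X ξ) := by
    have hA₀ := hirr {α | R.SameCycle k₀ (X (α, Side.b))} ?_
    · have hb : ∀ α, R.SameCycle k₀ (X (α, Side.b)) := by
        rcases hA₀ with h1 | h1
        · have : y.1.1 ∈ {α | R.SameCycle k₀ (X (α, Side.b))} := Equiv.Perm.SameCycle.refl _ _
          rw [h1] at this
          exact this.elim
        · intro α
          have : α ∈ {α | R.SameCycle k₀ (X (α, Side.b))} := by rw [h1]; trivial
          exact this
      rintro ⟨α, _ | _⟩
      · exact hb α
      · rw [hXe, Equiv.Perm.sameCycle_pow_right]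
        exact hb α
    · have hd : doubled {α | R.SameCycle k₀ (X (α, Side.b))} = {ξ | R.SameCycle k₀ (X ξ)} := by
        ext ⟨α, _ | _⟩
        · rfl
        · change R.SameCycle k₀ (X (α, Side.b)) ↔ R.SameCycle k₀ (X (α, Side.e))
          rw [hXe, Equiv.Perm.sameCycle_pow_right]
      rw [hd]
      ext ξ
      constructor
      · rintro ⟨η, hη, rfl⟩
        change R.SameCycle k₀ (X (σ η))
        rw [hXσ]
        exact hη
      · intro hξ
        refine ⟨σ.symm ξ, ?_, by simp⟩
        change R.SameCycle k₀ (X (σ.symm ξ))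
        rw [← hXσ, Equiv.apply_symm_apply]
        exact hξ
  choose n hn using fun ξ => (htrans ξ).exists_nat_pow_eq
  set g := MulAction.period R k₀ with hg
  have hdvd : ∀ a b : ℕ, (R ^ a) k₀ = (R ^ b) k₀ → (g : ℤ) ∣ (a : ℤ) - b := by
    intro a b hab
    rw [hg, ← MulAction.zpow_smul_eq_iff_period_dvd, sub_eq_neg_add, zpow_add, mul_smul,
      zpow_neg, inv_smul_eq_iff, zpow_natCast, zpow_natCast]
    exact hab
  have hnb : ∀ α, (g : ℤ) ∣ (n (σ (α, Side.b)) : ℤ) - n (α, Side.b) := fun α =>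
    hdvd _ _ (by rw [hn, hn, hXσ])
  have hne : ∀ α, (g : ℤ) ∣ (n (α, Side.e) : ℤ) -
      (x (σ (α, Side.e)) - x (α, Side.b) + n (α, Side.b)) := fun α => by
    have := hdvd (n (α, Side.e)) ((x (σ (α, Side.e)) - x (α, Side.b)).toNat + n (α, Side.b))
      (by rw [hn, pow_add, Equiv.Perm.mul_apply, hn, hXe])
    push_cast at this
    rwa [Int.toNat_of_nonneg (by have := h.pos α; omega)] at this
  have hnσ : ∀ α, (g : ℤ) ∣ (n (σ (α, Side.e)) : ℤ) - n (α, Side.e) := fun α =>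
    hdvd _ _ (by rw [hn, hn, hXσ])
  -- the coordinate `n - x` is constant along the dual cycles modulo `g`
  have hcinv : ∀ ξ, (((n (σ.dual ξ) : ℤ) - x (σ.dual ξ) : ℤ) : ZMod g) =
      (((n ξ : ℤ) - x ξ : ℤ) : ZMod g) := by
    rintro ⟨α, _ | _⟩
    · rw [eq_comm, ZMod.intCast_eq_intCast_iff_dvd_sub, dual_b]
      obtain ⟨k, hk⟩ := hnσ α
      obtain ⟨j, hj⟩ := hne α
      exact ⟨k + j, by linear_combination hk + hj⟩
    · rw [eq_comm, ZMod.intCast_eq_intCast_iff_dvd_sub, dual_e]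
      obtain ⟨k, hk⟩ := hnb α
      obtain ⟨j, hj⟩ := hne α
      exact ⟨k - j, by linear_combination hk - hj - h.allowed α⟩
  let Q := Quotient (Equiv.Perm.SameCycle.setoid σ.dual)
  let m : A × Side → Q := Quotient.mk _
  have hm : ∀ ξ, σ.dual.SameCycle (m ξ).out ξ := fun ξ =>
    Quotient.mk_out (s := Equiv.Perm.SameCycle.setoid σ.dual) ξ
  have hmσ : ∀ ξ, m (σ.dual ξ) = m ξ := fun ξ =>
    Quotient.sound (Equiv.Perm.sameCycle_apply_left.2 (Equiv.Perm.SameCycle.refl _ _))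
  let c : A × Side → ℤ := fun ξ => (n (m ξ).out : ℤ) - x (m ξ).out
  have hc : ∀ ξ, (g : ℤ) ∣ c ξ - ((n ξ : ℤ) - x ξ) := fun ξ => by
    rw [← ZMod.intCast_eq_intCast_iff_dvd_sub]
    exact Equiv.Perm.SameCycle.eq_of_invariant (τ := σ.dual)
      (h := fun ξ => (((n ξ : ℤ) - x ξ : ℤ) : ZMod g)) hcinv (hm ξ).symm
  have hg1 : g = 1 := by
    refine h.primitive g (fun ξ => x ξ + c ξ) (fun ξ => ?_) (fun α => ?_)
    · simp only [c, hmσ]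
      ring
    · obtain ⟨i, hi⟩ := hc (σ (α, Side.b))
      obtain ⟨j, hj⟩ := hc (α, Side.b)
      obtain ⟨k, hk⟩ := hnb α
      exact ⟨i - j + k, by linear_combination hi - hj + hk⟩
  have hR : R k₀ = k₀ := by
    have := (MulAction.zpow_smul_eq_iff_period_dvd (j := 1) (g := R) (a := k₀)).2 (by
      rw [← hg, hg1]; simp)
    simpa using this
  have hRn : ∀ n : ℕ, (R ^ n) k₀ = k₀ := by
    intro n
    induction n with
    | zero => simp
    | succ n ih => rw [pow_succ, Equiv.Perm.mul_apply, hR, ih]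
  have hqk : ∀ z, q z = k₀ := fun z => by
    rw [hc1 z, ← hn (z.1.1, Side.b), hRn, hRn]
  have : q y = q y' := by rw [hqk, hqk]
  exact Quotient.exact this

end IsTowerModel

end Scheme

/-! ### Realization on a circle -/

/-- The elements of a single cycle are numbered along the cycle. -/
theorem Equiv.Perm.exists_index {B : Type*} [Finite B] (τ : Equiv.Perm B) (y₀ : B)
    (h : ∀ y, τ.SameCycle y₀ y) :
    ∃ N : ℕ, 0 < N ∧ (τ ^ N) y₀ = y₀ ∧ ∃ k : B → ℕ, (∀ y, k y < N ∧ (τ ^ k y) y₀ = y) ∧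
      ∀ i, i < N → k ((τ ^ i) y₀) = i := by
  set N := MulAction.period τ y₀ with hN
  have hNpos : 0 < N := MulAction.period_pos_of_orderOf_pos (orderOf_pos τ) y₀
  have hmod : ∀ n : ℕ, (τ ^ (n % N)) y₀ = (τ ^ n) y₀ := fun n =>
    MulAction.pow_mod_period_smul n (m := τ) (a := y₀)
  have hNy : (τ ^ N) y₀ = y₀ := MulAction.pow_period_smul τ y₀
  have hex : ∀ y, ∃ i, i < N ∧ (τ ^ i) y₀ = y := by
    intro y
    obtain ⟨n, hn⟩ := (h y).exists_nat_pow_eq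
    exact ⟨n % N, Nat.mod_lt _ hNpos, (hmod n).trans hn⟩
  choose k hk using hex
  have hinj : ∀ i j, i ≤ j → j < N → (τ ^ i) y₀ = (τ ^ j) y₀ → i = j := by
    intro i j hij hj heq
    have h1 : (τ ^ (j - i)) y₀ = y₀ := by
      apply (τ ^ i).injective
      rw [← Equiv.Perm.mul_apply, ← pow_add, Nat.add_sub_cancel' hij, heq]
    have h2 : N ∣ j - i := MulAction.pow_smul_eq_iff_period_dvd.1 h1
    have := Nat.eq_zero_of_dvd_of_lt h2 (by omega)
    omega
  refine ⟨N, hNpos, hNy, k, hk, fun i hi => ?_⟩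
  obtain ⟨h1, h2⟩ := hk ((τ ^ i) y₀)
  rcases le_total (k ((τ ^ i) y₀)) i with h3 | h3
  · exact hinj _ _ h3 hi h2
  · exact (hinj _ _ h3 h1 h2.symm).symm

namespace Scheme.IsTowerModel

variable {A : Type u} [Finite A]

/-- If the floors, numbered by `k`, are laid one after another on the line with divisions at
`S 0 = 0, S 1, …, S N`, and the vertical move acts on the circle of length `S N` as a translation,
then the original interval exchange is the first return map to the bottoms of the towers. -/
theorem realize {E : IRE A} (hE : E.IsIntervalExchange) {x : A × Side → ℤ}
    (h : E.scheme.IsTowerModel x) {τ : Equiv.Perm (Floor E.scheme x)}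
    (hτ : E.scheme.IsRightNeighbour x τ) {N : ℕ} {k : Floor E.scheme x → ℕ} {S : ℕ → ℝ}
    {X : A × Side → ℝ} {M : ℝ} {α₀ β₀ : A} (h₀ : E.scheme (β₀, Side.e) = (α₀, Side.b))
    (hkN : ∀ y, k y < N) (hkinj : Function.Injective k)
    (hksurj : ∀ i < N, ∃ y, k y = i) (hkτ : ∀ y, k y + 1 < N → k (τ y) = k y + 1)
    (hkτ' : ∀ y, k y + 1 = N → τ y = h.bottom α₀) (hS₀ : S 0 = 0)
    (hS : ∀ y, S (k y + 1) = S (k y) + E.length y.1.1)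
    (hXb : ∀ α, X (α, Side.b) = S (k (h.bottom α)))
    (hXσ : ∀ ξ, X (E.scheme ξ) - X ξ = E.x (E.scheme ξ) - E.x ξ)
    (hM : ∀ y, above (fun y => (S (k y) : AddCircle (S N))) (fun ξ => (X ξ : AddCircle (S N))) y =
      (S (k y) : AddCircle (S N)) + (M : AddCircle (S N))) :
    ∃ (Γ : Set (AddCircle (S N))) (F : IRE A), 0 < S N ∧ IsUnionOfArcs (S N) Γ ∧
      IsCutPoint (S N) Γ 0 ∧ F.IsFirstReturnMap (S N) M Γ 0 ∧ F.ShiftEquivalent E := by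
  have hfin := Fintype.ofFinite A
  have hσpk := hE.2.uniquePeaks
  have hstep : ∀ i < N, S i < S (i + 1) := by
    intro i hi
    obtain ⟨y, rfl⟩ := hksurj i hi
    rw [hS]
    linarith [hE.1 y.1.1]
  have hmono : ∀ i j, i ≤ j → j ≤ N → S i ≤ S j := by
    intro i j hij
    induction j, hij using Nat.le_induction with
    | base => exact fun _ => le_rfl
    | succ j hij ih => exact fun hj => (ih (by omega)).trans (hstep j (by omega)).le
  have hNpos : 0 < N := (Nat.zero_le _).trans_lt (hkN (h.bottom α₀))
  have hL : 0 < S N := by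
    have h1 := hstep 0 hNpos
    have h2 := hmono 1 N hNpos le_rfl
    rw [zero_add] at h1
    linarith
  have hfact : Fact (0 < S N) := ⟨hL⟩
  have hSnn : ∀ i ≤ N, 0 ≤ S i := fun i hi => hS₀ ▸ hmono 0 i (Nat.zero_le _) hi
  have hallow : E.scheme.Allows X := by
    intro α
    have h1 := hXσ (α, Side.b)
    have h2 := hXσ (α, Side.e)
    have h3 := E.allowed α
    linarith
  let F : IRE A := ⟨E.scheme, X, hallow⟩
  have hlen : F.length = E.length := by
    funext α
    exact hXσ (α, Side.b)
  have hF : F.IsIntervalExchange := ⟨fun α => by rw [hlen]; exact hE.1 α, hE.2⟩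
  have hXσb : ∀ α, X (E.scheme (α, Side.b)) = S (k (h.bottom α) + 1) := by
    intro α
    have h1 := hXσ (α, Side.b)
    rw [hS, ← hXb]
    have h2 : E.length (h.bottom α).1.1 = E.x (E.scheme (α, Side.b)) - E.x (α, Side.b) := rfl
    rw [h2]
    linarith
  have hbegin : ∀ α, F.beginInterval α = Set.Ico (S (k (h.bottom α))) (S (k (h.bottom α) + 1)) := by
    intro α
    change Set.Ico (X (α, Side.b)) (X (E.scheme (α, Side.b))) = _
    rw [hXb, hXσb]
  have hbot : ∀ {α β}, k (h.bottom α) = k (h.bottom β) → α = β := fun {α β} hαβ =>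
    congrArg (fun y => y.1.1) (hkinj hαβ)
  have hlt : ∀ {i j t}, i < N → j < N → t ∈ Set.Ico (S i) (S (i + 1)) →
      t ∈ Set.Ico (S j) (S (j + 1)) → i = j := by
    have aux : ∀ i j t, j < N → t ∈ Set.Ico (S i) (S (i + 1)) →
        t ∈ Set.Ico (S j) (S (j + 1)) → ¬ i < j := by
      intro i j t hj hti htj hij
      have := hmono (i + 1) j hij hj.le
      linarith [hti.2, htj.1]
    intro i j t hi hj hti htj
    exact le_antisymm (not_lt.1 (aux j i t hi htj hti)) (not_lt.1 (aux i j t hj hti htj))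
  have hmem : ∀ {i t}, i < N → t ∈ Set.Ico (S i) (S (i + 1)) → t ∈ Set.Ico 0 (0 + S N) := by
    intro i t hi ht
    exact ⟨(hSnn i hi.le).trans ht.1, by rw [zero_add]; exact ht.2.trans_le (hmono _ _ hi le_rfl)⟩
  set Γ : Set (AddCircle (S N)) :=
    ⋃ α, circleArc (S N) (X (α, Side.b)) (X (E.scheme (α, Side.b))) with hΓdef
  have harc : ∀ α, circleArc (S N) (X (α, Side.b)) (X (E.scheme (α, Side.b))) =
      (fun t : ℝ => (t : AddCircle (S N))) '' F.beginInterval α := fun α => rfl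
  -- a floor meets `Γ` only if it is the bottom of a tower
  have hΓ : ∀ i t, i < N → t ∈ Set.Ico (S i) (S (i + 1)) → (t : AddCircle (S N)) ∈ Γ →
      ∃ β, k (h.bottom β) = i := by
    intro i t hi ht htΓ
    obtain ⟨β, hβ⟩ := Set.mem_iUnion.1 htΓ
    rw [harc, hbegin] at hβ
    obtain ⟨s, hs, hst⟩ := hβ
    have := (AddCircle.coe_eq_coe_iff_of_mem_Ico (hmem (hkN _) hs) (hmem hi ht)).1 hst
    subst this
    exact ⟨β, hlt (hkN _) hi hs ht⟩
  have hΓbegin : ∀ α, ∀ t ∈ F.beginInterval α, (t : AddCircle (S N)) ∈ Γ := fun α t ht =>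
    Set.mem_iUnion.2 ⟨α, t, ht, rfl⟩
  have htouch : ∀ {α β}, k (h.bottom α) + 1 = k (h.bottom β) →
      E.scheme.SameCycle (α, Side.b) (β, Side.b) := by
    intro α β hαβ
    have h1 := hkτ (h.bottom α) (by rw [hαβ]; exact hkN _)
    have h2 := h.eq_of_right_bottom hτ (hkinj (h1.trans hαβ))
    rw [← h2]
    simp [Equiv.Perm.SameCycle.refl]
  obtain ⟨hc1, hc2⟩ := h.climb (ρ := fun q => q + (M : AddCircle (S N))) hM
    (fun α => by rw [hXb])
  have hiter : ∀ (n : ℕ) (q : AddCircle (S N)),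
      (fun q => q + (M : AddCircle (S N)))^[n] q = q + n • (M : AddCircle (S N)) :=
    fun n q => iterate_circleRotation n q
  simp only [hiter] at hc1 hc2
  have hXN : ∀ α, X (E.scheme (α, Side.b)) ≤ S N := fun α => by
    rw [hXσb]; exact hmono _ _ (hkN _) le_rfl
  refine ⟨Γ, F, hL, ?_, ?_, ⟨hF, ?_, ?_, ?_⟩, rfl, hlen⟩
  · classical
    refine ⟨Finset.univ.image fun α => (X (α, Side.b), X (E.scheme (α, Side.b))), ?_, ?_, ?_⟩
    · exact ⟨_, Finset.mem_image_of_mem _ (Finset.mem_univ α₀)⟩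
    · intro p hp
      obtain ⟨α, -, rfl⟩ := Finset.mem_image.1 hp
      refine ⟨hF.1.rises.up α, (hXN α).trans ?_⟩
      have : 0 ≤ X (α, Side.b) := by rw [hXb]; exact hSnn _ (hkN _).le
      linarith
    · rw [hΓdef]
      ext q
      simp
  · -- to the left of the cut there is the last floor, which is not the bottom of a tower
    refine Or.inr fun hint => ?_
    have h1 : ((S N : ℝ) : AddCircle (S N)) ∈ interior Γ := by
      rw [AddCircle.coe_period]
      simpa using hint
    have e1 : ∀ᶠ t : ℝ in nhds (S N), (t : AddCircle (S N)) ∈ interior Γ :=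
      (AddCircle.continuous_mk' (S N)).continuousAt.eventually (isOpen_interior.mem_nhds h1)
    have hN1 : N - 1 + 1 = N := Nat.sub_add_cancel hNpos
    have hlast := hstep (N - 1) (by omega)
    rw [hN1] at hlast
    obtain ⟨t, ht1, ht2⟩ := ((e1.filter_mono nhdsWithin_le_nhds).and (Ioo_mem_nhdsLT hlast)).exists
    obtain ⟨β, hβ⟩ := hΓ (N - 1) t (by omega) (by rw [hN1]; exact ⟨ht2.1.le, ht2.2⟩)
      (interior_subset ht1)
    have h2 := h.eq_of_right_bottom hτ (hkτ' (h.bottom β) (by omega))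
    have h3 := E.scheme.injective (h2.trans h₀.symm)
    simp at h3
  · intro ξ η hξη
    have hclos : ∀ ζ, closure (F.segment ζ) ⊆
        ⋃ α ∈ {α : A | E.scheme.SameCycle ζ (α, Side.b)},
          Set.Icc (S (k (h.bottom α))) (S (k (h.bottom α) + 1)) := by
      intro ζ
      rw [IRE.segment, (Set.toFinite _).closure_biUnion]
      refine Set.iUnion₂_mono fun α _ => ?_
      rw [hbegin, closure_Ico (hstep _ (hkN _)).ne]
    rw [Set.disjoint_left]
    intro t ht1 ht2
    obtain ⟨α, hα, htα⟩ := Set.mem_iUnion₂.1 (hclos ξ ht1)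
    obtain ⟨β, hβ, htβ⟩ := Set.mem_iUnion₂.1 (hclos η ht2)
    have aux : ∀ α β, t ∈ Set.Icc (S (k (h.bottom α))) (S (k (h.bottom α) + 1)) →
        t ∈ Set.Icc (S (k (h.bottom β))) (S (k (h.bottom β) + 1)) →
        k (h.bottom α) < k (h.bottom β) → E.scheme.SameCycle (α, Side.b) (β, Side.b) := by
      intro α β htα htβ hlt
      refine htouch ?_
      by_contra hne
      have h1 := hstep (k (h.bottom α) + 1) (by have := hkN (h.bottom β); omega)
      have h2 := hmono (k (h.bottom α) + 1 + 1) (k (h.bottom β)) (by omega) (hkN _).le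
      linarith [htα.2, htβ.1]
    have hαβ : E.scheme.SameCycle (α, Side.b) (β, Side.b) := by
      rcases lt_trichotomy (k (h.bottom α)) (k (h.bottom β)) with h1 | h1 | h1
      · exact aux α β htα htβ h1
      · rw [hbot h1]
      · exact (aux β α htβ htα h1).symm
    exact hξη (hα.trans (hαβ.trans hβ.symm))
  · ext t
    constructor
    · intro ht
      obtain ⟨α, hα⟩ := Set.mem_iUnion.1 ht
      exact ⟨hmem (hkN _) (by rw [← hbegin]; exact hα), hΓbegin α t hα⟩
    · rintro ⟨ht, htΓ⟩
      obtain ⟨β, hβ⟩ := Set.mem_iUnion.1 htΓ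
      rw [harc] at hβ
      obtain ⟨s, hs, hst⟩ := hβ
      have := (AddCircle.coe_eq_coe_iff_of_mem_Ico
        (hmem (hkN _) (by rw [← hbegin]; exact hs)) ht).1 hst
      subst this
      exact Set.mem_iUnion.2 ⟨β, hs⟩
  · rintro t s ⟨α, ht, rfl⟩
    have hpos := h.pos α
    have ht' := ht
    rw [hbegin] at ht'
    have htX : (t : AddCircle (S N)) = ((t - X (α, Side.b) : ℝ) : AddCircle (S N)) +
        (X (α, Side.b) : AddCircle (S N)) := by
      rw [← AddCircle.coe_add, sub_add_cancel]
    refine ⟨(x (E.scheme (α, Side.e)) - x (α, Side.b)).toNat, by omega, ?_, ?_, fun i hi hi' => ?_⟩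
    · rw [iterate_circleRotation, htX, add_assoc, ← hc2, ← AddCircle.coe_add]
    · have hs : t - X (α, Side.b) + X (E.scheme (α, Side.e)) ∈
          Set.Ico (X (E.scheme (α, Side.e))) (X (α, Side.e)) := by
        have h1 : X (α, Side.b) ≤ t := ht.1
        have h2 : t < X (E.scheme (α, Side.b)) := ht.2
        exact ⟨by linarith, by linarith [hallow α]⟩
      obtain ⟨β, -, hβ⟩ := hF.1.rises.exists_begin hs
      exact hΓbegin β _ hβ
    · rw [iterate_circleRotation, htX, add_assoc]
      have hy := hc1 ⟨(α, x (α, Side.b) + i), by dsimp only; omega, by dsimp only; omega⟩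
      set y : Floor E.scheme x := ⟨(α, x (α, Side.b) + i), by dsimp only; omega,
        by dsimp only; omega⟩ with hydef
      have hyi : (y.1.2 - x (y.1.1, Side.b)).toNat = i := by
        simp [hydef]
      rw [hyi] at hy
      have hyα : (X (y.1.1, Side.b) : AddCircle (S N)) = X (α, Side.b) := rfl
      rw [hyα] at hy
      rw [← hy, ← AddCircle.coe_add]
      intro hcon
      have hSy := hS y
      have hlα : E.length y.1.1 = X (E.scheme (α, Side.b)) - X (α, Side.b) := by
        rw [hXσ (α, Side.b)]; rfl
      rw [hlα] at hSy
      obtain ⟨β, hβ⟩ := hΓ (k y) _ (hkN y) (by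
        have h1 : X (α, Side.b) ≤ t := ht.1
        have h2 : t < X (E.scheme (α, Side.b)) := ht.2
        exact ⟨by linarith, by linarith⟩) hcon
      have h3 := hkinj hβ
      have h4 : β = α := congrArg (fun y => y.1.1) h3
      subst h4
      have h5 : x (β, Side.b) = x (β, Side.b) + i := congrArg (fun y => y.1.2) h3
      omega

/-- The circle is built from the floors with widths given by the lengths. Its length and the angle
of rotation are linear functions of the endpoints; the tower model itself, taken for the vector of
endpoints, contributes nothing to the length and one unit to the angle, because the positions that
it defines are the vertical coordinates. -/
theorem exists_realization {σ : Scheme A} [Nonempty A] (hirr : σ.Irreducible)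
    (hrot : σ.IsRotational) {x : A × Side → ℤ} (h : σ.IsTowerModel x) :
    ∃ ℓ m : (A × Side → ℝ) → ℝ,
      (∀ z θ, ℓ (fun ξ => z ξ + θ * x ξ) = ℓ z) ∧
      (∀ z θ, m (fun ξ => z ξ + θ * x ξ) = m z + θ) ∧
      ∀ E : IRE A, E.scheme = σ → E.Positive → ∃ (Γ : Set (AddCircle (ℓ E.x))) (F : IRE A),
        0 < ℓ E.x ∧ IsUnionOfArcs (ℓ E.x) Γ ∧ IsCutPoint (ℓ E.x) Γ 0 ∧
        F.IsFirstReturnMap (ℓ E.x) (m E.x) Γ 0 ∧ F.ShiftEquivalent E := by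
  have hσ := hrot.1.uniquePeaks
  have hσ' := hrot.2.uniquePeaks
  obtain ⟨v, hv, hvpos⟩ := hrot.1.1
  have hvr := Rises.of_allows hv hvpos
  obtain ⟨τ, hτ⟩ := h.exists_right hσ'
  obtain ⟨r, hr, hrc⟩ := hvr.exists_representative
  obtain ⟨β₀, α₀, h₀, -⟩ := hvr.exists_valley (Classical.arbitrary A, Side.b)
  set y₀ := h.bottom α₀ with hy₀
  obtain ⟨N, hNpos, hNy, k, hk, hki⟩ := Equiv.Perm.exists_index τ y₀ fun y =>
    h.sameCycle_right hσ hσ' hirr hvr hτ y₀ y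
  have hk₀ : k y₀ = 0 := by simpa using hki 0 hNpos
  have hkinj : Function.Injective k := fun y y' hyy => by
    rw [← (hk y).2, ← (hk y').2, hyy]
  have hτpow : ∀ y, (τ ^ (k y + 1)) y₀ = τ y := fun y => by
    rw [pow_succ', Equiv.Perm.mul_apply, (hk y).2]
  have hkτ : ∀ y, k y + 1 < N → k (τ y) = k y + 1 := fun y hy => by
    rw [← hτpow, hki _ hy]
  have hkτ' : ∀ y, k y + 1 = N → τ y = y₀ := fun y hy => by
    rw [← hτpow, hy, hNy]
  let S : (A × Side → ℝ) → ℕ → ℝ := fun z n => ∑ i ∈ Finset.range n,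
    (z (σ (((τ ^ i) y₀).1.1, Side.b)) - z (((τ ^ i) y₀).1.1, Side.b))
  -- each cycle of `σ` is shifted so as to put its beginning intervals on the bottoms of the towers
  let X : (A × Side → ℝ) → A × Side → ℝ := fun z ξ =>
    z ξ + (S z (k (h.bottom (r ξ))) - z (r ξ, Side.b))
  have hSadd : ∀ z θ n, S (fun ξ => z ξ + θ * x ξ) n = S z n + θ * S (fun ξ => x ξ) n := by
    intro z θ n
    simp only [S]
    rw [Finset.mul_sum, ← Finset.sum_add_distrib]
    exact Finset.sum_congr rfl fun i _ => by ring
  -- for the tower model itself, the positions are the vertical coordinates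
  have hSx : ∀ n, S (fun ξ => x ξ) n = ((τ ^ n) y₀).1.2 - y₀.1.2 := by
    intro n
    induction n with
    | zero => simp [S]
    | succ n ih =>
      have h1 : S (fun ξ => (x ξ : ℝ)) (n + 1) = S (fun ξ => (x ξ : ℝ)) n +
          (x (σ (((τ ^ n) y₀).1.1, Side.b)) - x (((τ ^ n) y₀).1.1, Side.b)) :=
        Finset.sum_range_succ _ _
      rw [h1, ih, pow_succ', Equiv.Perm.mul_apply, (hτ _).2]
      push_cast
      ring
  have hSk : ∀ y, S (fun ξ => x ξ) (k y) = y.1.2 - y₀.1.2 := fun y => by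
    rw [hSx, (hk y).2]
  -- the angle is the place above the first floor, whose own place is `0`
  refine ⟨fun z => S z N, fun z => above (fun y => S z (k y)) (X z) y₀, fun z θ => ?_,
    fun z θ => ?_, ?_⟩
  · simp only [hSadd, hSx N, hNy]
    simp
  · unfold above
    split_ifs with hif
    · simp only [hSadd, hSk]
      push_cast
      ring
    · simp only [X, hSadd, hSk]
      have h1 : y₀.1.2 + 1 = x (σ (y₀.1.1, Side.e)) := by
        have := y₀.2.2
        omega
      have h2 : (y₀.1.2 : ℝ) + 1 = x (σ (y₀.1.1, Side.e)) := by exact_mod_cast h1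
      have h3 : ∀ α, (h.bottom α).1.2 = x (α, Side.b) := fun α => rfl
      rw [h3, ← h2]
      ring
  · rintro ⟨σ', z, hz⟩ hσE hE
    obtain rfl : σ = σ' := hσE.symm
    let E : IRE A := ⟨σ, z, hz⟩
    have hlen : ∀ α, E.length α = z (σ (α, Side.b)) - z (α, Side.b) := fun _ => rfl
    have hSsucc : ∀ y, S z (k y + 1) = S z (k y) + E.length y.1.1 := by
      intro y
      have h1 : S z (k y + 1) = S z (k y) +
          (z (σ (((τ ^ k y) y₀).1.1, Side.b)) - z (((τ ^ k y) y₀).1.1, Side.b)) :=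
        Finset.sum_range_succ _ _
      rw [h1, (hk y).2]
      rfl
    have hXσ : ∀ ξ, X z (σ ξ) - X z ξ = z (σ ξ) - z ξ := fun ξ => by
      simp only [X, hr]
      ring
    have hXb : ∀ α, X z (α, Side.b) = S z (k (h.bottom α)) := by
      intro α
      have hconst : S z (k (h.bottom α)) - z (α, Side.b) =
          S z (k (h.bottom (r (α, Side.b)))) - z (r (α, Side.b), Side.b) := by
        refine hvr.eq_of_sameCycle hσ (f := fun α => S z (k (h.bottom α)) - z (α, Side.b))
          (fun α β hαβ => ?_) (hrc (α, Side.b))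
        have h1 := h.right_bottom hσ' hτ hαβ
        have h2 : k (h.bottom α) + 1 < N := by
          refine lt_of_le_of_ne (hk _).1 fun hN => ?_
          have h3 := hkτ' _ hN
          rw [h1] at h3
          have h4 : β = α₀ := congrArg (fun y => y.1.1) h3
          subst h4
          have h5 := σ.injective (hαβ.trans h₀.symm)
          simp at h5
        have h3 := hkτ _ h2
        rw [h1] at h3
        have h4 := hSsucc (h.bottom α)
        have h5 : E.length (h.bottom α).1.1 = z (σ (α, Side.b)) - z (α, Side.b) := rfl
        rw [h5, hαβ] at h4
        rw [h3, h4]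
        ring
      simp only [X]
      rw [← hconst]
      ring
    have hp : ∀ y, (S z (k (τ y)) : AddCircle (S z N)) =
        (S z (k y) : AddCircle (S z N)) + (E.length y.1.1 : AddCircle (S z N)) := by
      intro y
      rw [← AddCircle.coe_add, ← hSsucc]
      rcases (Nat.succ_le_of_lt (hk y).1).lt_or_eq with h1 | h1
      · rw [hkτ y h1]
      · have h2 : k y + 1 = N := h1
        rw [hkτ' y h1, hk₀, h2, AddCircle.coe_period]
        simp [S]
    have hab : ∀ y, above (fun y => (S z (k y) : AddCircle (S z N)))
        (fun ξ => (X z ξ : AddCircle (S z N))) (τ y) =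
        above (fun y => (S z (k y) : AddCircle (S z N)))
          (fun ξ => (X z ξ : AddCircle (S z N))) y + (E.length y.1.1 : AddCircle (S z N)) := by
      intro y
      refine h.above_right hσ' hτ (a := fun α q => q + (E.length α : AddCircle (S z N))) hp
        (fun α => by rw [hXb]) (fun α => ?_) (fun α => ?_) y
      · rw [← AddCircle.coe_add]
        congr 1
        linarith [hXσ (α, Side.b), hlen α]
      · rw [← AddCircle.coe_add]
        congr 1
        linarith [hXσ (α, Side.e), hz α, hlen α]
    have hM : ∀ y, above (fun y => (S z (k y) : AddCircle (S z N)))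
        (fun ξ => (X z ξ : AddCircle (S z N))) y = (S z (k y) : AddCircle (S z N)) +
        ((above (fun y => S z (k y)) (X z) y₀ : ℝ) : AddCircle (S z N)) := by
      intro y
      have h1 : above (fun y => (S z (k y) : AddCircle (S z N)))
          (fun ξ => (X z ξ : AddCircle (S z N))) y - (S z (k y) : AddCircle (S z N)) =
          above (fun y => (S z (k y) : AddCircle (S z N)))
          (fun ξ => (X z ξ : AddCircle (S z N))) y₀ - (S z (k y₀) : AddCircle (S z N)) :=
        Equiv.Perm.SameCycle.eq_of_invariant (τ := τ)
          (h := fun y => above (fun y => (S z (k y) : AddCircle (S z N)))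
            (fun ξ => (X z ξ : AddCircle (S z N))) y - (S z (k y) : AddCircle (S z N)))
          (fun y => by simp only [hab, hp]; abel)
          (h.sameCycle_right hσ hσ' hirr hvr hτ y y₀)
      have h2 : above (fun y => (S z (k y) : AddCircle (S z N)))
          (fun ξ => (X z ξ : AddCircle (S z N))) y₀ =
          ((above (fun y => S z (k y)) (X z) y₀ : ℝ) : AddCircle (S z N)) := by
        unfold above
        split_ifs <;> rfl
      have h3 : (S z (k y₀) : AddCircle (S z N)) = 0 := by
        rw [hk₀]
        simp [S]
      rw [h2, h3, sub_zero] at h1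
      rw [← h1]
      abel
    exact realize (E := E) ⟨hE, hrot.1⟩ h hτ h₀ (fun y => (hk y).1) hkinj
      (fun i hi => ⟨_, hki i hi⟩) hkτ hkτ' (by simp [S]) hSsucc hXb hXσ hM

end Scheme.IsTowerModel

/-- A tower model contributes only to the angle of the rotation, so a small multiple of it can be
added to any positive vector of endpoints in order to make the angle irrational. -/
theorem Scheme.IsRotational.exists_irrationalRotation {A : Type u} [Finite A] [Nonempty A]
    {σ : Scheme A} (hirr : σ.Irreducible) (hrot : σ.IsRotational) :
    ∃ (L M : ℝ) (Γ : Set (AddCircle L)) (F : IRE A), 0 < L ∧ IrrationalRotation L M ∧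
      IsUnionOfArcs L Γ ∧ IsCutPoint L Γ 0 ∧ F.IsFirstReturnMap L M Γ 0 ∧ F.scheme = σ := by
  obtain ⟨x, hx⟩ := hrot.exists_isTowerModel
  obtain ⟨ℓ, m, hℓ, hm, hreal⟩ := hx.exists_realization hirr hrot
  suffices ∃ E : IRE A, E.scheme = σ ∧ E.Positive ∧ Irrational (m E.x / ℓ E.x) by
    obtain ⟨E, hEσ, hE, hE'⟩ := this
    obtain ⟨Γ, F, hL, hΓ, hcut, hF, hFE, -⟩ := hreal E hEσ hE
    exact ⟨ℓ E.x, m E.x, Γ, F, hL, hE'.sub_intCast _, hΓ, hcut, hF, hFE.trans hEσ⟩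
  obtain ⟨z, hz, hzpos⟩ := hrot.1.1
  obtain ⟨-, -, hL, -⟩ := hreal ⟨σ, z, hz⟩ rfl hzpos
  change 0 < ℓ z at hL
  by_cases hq : Irrational (m z / ℓ z)
  · exact ⟨⟨σ, z, hz⟩, rfl, hzpos, hq⟩
  have htend : Filter.Tendsto (fun n : ℕ => √2 * ℓ z / n) Filter.atTop (nhds 0) :=
    tendsto_const_div_atTop_nhds_zero_nat _
  have hev : ∀ᶠ n : ℕ in Filter.atTop, ∀ α, 0 < (z (σ (α, Side.b)) - z (α, Side.b)) +
      √2 * ℓ z / n * (x (σ (α, Side.b)) - x (α, Side.b)) := by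
    rw [Filter.eventually_all]
    intro α
    have h1 := (htend.mul_const ((x (σ (α, Side.b)) : ℝ) - x (α, Side.b))).const_add
      (z (σ (α, Side.b)) - z (α, Side.b))
    rw [zero_mul, add_zero] at h1
    exact h1.eventually (lt_mem_nhds (hzpos α))
  obtain ⟨n, hn, hn0⟩ := (hev.and (Filter.eventually_gt_atTop 0)).exists
  have hallow : σ.Allows fun ξ => z ξ + √2 * ℓ z / n * x ξ := by
    intro α
    have h1 : (x (σ (α, Side.b)) : ℝ) + x (σ (α, Side.e)) = x (α, Side.b) + x (α, Side.e) := by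
      exact_mod_cast hx.allowed α
    linear_combination hz α + √2 * ℓ z / n * h1
  refine ⟨⟨σ, _, hallow⟩, rfl, fun α => ?_, ?_⟩
  · have h1 := hn α
    change 0 < _ - _
    dsimp only
    linarith
  · change Irrational (m (fun ξ => z ξ + √2 * ℓ z / n * x ξ) /
      ℓ (fun ξ => z ξ + √2 * ℓ z / n * x ξ))
    rw [hℓ, hm]
    obtain ⟨q, hq⟩ := not_not.1 hq
    have h1 : (m z + √2 * ℓ z / n) / ℓ z = q + √2 / n := by
      rw [hq]
      field_simp
    rw [h1]
    exact (irrational_sqrt_two.div_natCast hn0.ne').ratCast_add q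

theorem theorem1 :
    -- 1) first return maps of irrational circle rotations onto unions of arcs
    (∀ (L M : ℝ) (Γ : Set (AddCircle L)) (x₀ : ℝ), 0 < L → IrrationalRotation L M →
      IsUnionOfArcs L Γ → IsCutPoint L Γ x₀ →
      (∃ (d : ℕ) (E : IRE (Fin d)), E.IsFirstReturnMap L M Γ x₀) ∧
      (∀ (A : Type u) [Finite A] (E : IRE A), E.IsFirstReturnMap L M Γ x₀ →
        E.scheme.Irreducible ∧ E.IsRotational)) ∧
    -- 2) every irreducible rotational interval exchange is, up to shifts, such a map
    (∀ (A : Type u) [Finite A] [Nonempty A] (E : IRE A), E.scheme.Irreducible → E.IsRotational →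
      ∃ (L M : ℝ) (Γ : Set (AddCircle L)) (x₀ : ℝ) (F : IRE A), 0 < L ∧ IsUnionOfArcs L Γ ∧
        IsCutPoint L Γ x₀ ∧ F.IsFirstReturnMap L M Γ x₀ ∧ F.ShiftEquivalent E) ∧
    -- 3) characterization of rotational schemes
    (∀ (A : Type u) [Finite A] [Nonempty A] (σ : Scheme A), σ.Irreducible →
      σ.IsIntervalExchange →
      (σ.IsRotational ↔
        ∃ (L M : ℝ) (Γ : Set (AddCircle L)) (x₀ : ℝ) (F : IRE A), 0 < L ∧
          IrrationalRotation L M ∧ IsUnionOfArcs L Γ ∧ IsCutPoint L Γ x₀ ∧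
          F.IsFirstReturnMap L M Γ x₀ ∧ F.scheme = σ)) := by
  refine ⟨fun L M Γ x₀ hL hM hΓ _ => ⟨exists_isFirstReturnMap hL hM hΓ x₀, fun A _ E h =>
    ⟨h.irreducible hL hM, h.isRotational hL hM⟩⟩, fun A _ _ E hirr hE => ?_,
    fun A _ _ σ hirr _ => ⟨fun hrot => ?_, ?_⟩⟩
  · obtain ⟨x, hx⟩ := hE.2.exists_isTowerModel
    obtain ⟨ℓ, m, -, -, hreal⟩ := hx.exists_realization hirr hE.2
    obtain ⟨Γ, F, h⟩ := hreal E rfl hE.1.1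
    exact ⟨ℓ E.x, m E.x, Γ, 0, F, h⟩
  · obtain ⟨L, M, Γ, F, h⟩ := hrot.exists_irrationalRotation hirr
    exact ⟨L, M, Γ, 0, F, h⟩
  · rintro ⟨L, M, Γ, x₀, F, hL, hM, -, -, hF, rfl⟩
    exact (hF.isRotational hL hM).2
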